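/- Let $\Sigma=\{0,1\}^{\mathbb N}$ carry the metric $\rho(s,t)=2^{-n}$, where $n$ is the length of the longest common prefix of $s\neq t$, let $\sigma$ be the left shift, $\Sigma_n=\{0,1\}^n$, $\Sigma_*=\bigcup_{n\ge 0}\Sigma_n$, let $t|_n$ be the prefix of length $n$ of $t$, let $[w]$ be the cylinder of a word $w$, and $\lambda(w)=\sum_{i=1}^{|w|}w_i2^{-i}$. For a nonempty closed set $X\subset\Sigma$ with $\sigma(X)\subset X$ and a Hölder continuous $\varphi:\Sigma\to\mathbb R$ let $$P_X(\varphi)=\lim_{n\to\infty}\frac1n\log\sum_{w\in\Sigma_n:\,[w]\cap X\neq\emptyset}\exp\Big(\max_{t\in[w]}\sum_{i=0}^{n-1}\varphi(\sigma^i t)\Big)$$ be the topological pressure of $\varphi$ on $X$. Let $\psi:\mathbb R\to\mathbb R$ be a function whose set of zeros $\mathcal Z=\{x\in[0,1]:\psi(x)=0\}$ is finite. For $x\in[0,1)$ let $x|_k$ be the word $w\in\Sigma_k$ with $\lambda(w)\le x<\lambda(w)+2^{-k}$, and let $1|_k=1\cdots1$. For $k\ge2$ let $\mathcal F_k=\bigcup_{x\in\mathcal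 Z}\mathcal F_k(x)$, where $\mathcal F_k(x)=\{x|_k\}$ if $x\notin\lambda(\Sigma_*)$ and $\mathcal F_k(x)=\{w\in\Sigma_k:0\le\lambda(x|_k)-\lambda(w)\le2^{-k}\}$ otherwise, and let $$Y_k=\{t\in\Sigma:\ \sigma^m(t)|_k\notin\mathcal F_k\ \ \forall m\ge0\}.$$ Consider the directed graph on $\Sigma_{k-1}$ with an edge from $a_1\cdots a_{k-1}$ to $a_2\cdots a_k$ for every $a_1\cdots a_k\in\Sigma_k\setminus\mathcal F_k$. The topologically transitive pieces of $Y_k$ are the sets $\{t\in Y_k:\sigma^m(t)|_{k-1}\in C\ \ \forall m\ge0\}$, where $C$ is an irreducible class of this graph, that is, the set of all vertices that are joined to and from some given vertex $u$ by paths of length at least $1$, where $u$ lies on a closed path of length at least $1$. Let $k_0\ge2$, and for each $k\ge k_0$ let $X_k$ be a topologically transitive piece of $Y_k$ with $\overline{\dim}_B X_k=\overline{\dim}_B Y_k$, where $\overline{\dim}_B$ is the upper box-counting dimension. Let $\varphi:\Sigma\to\mathbb R$ be Hölder continuous. Then the limits defining $P_\Sigma(q\varphi)$ and $P_{X_k}(q\varphi)$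 exist for all $q\in\mathbb R$ and $k\ge k_0$, these pressures are differentiable functions of $q\in\mathbb R$, and for every $q\in\mathbb R$ $$\lim_{k\to\infty}P_{X_k}(q\varphi)=P_\Sigma(q\varphi).$$ Moreover, on every compact interval of values of $q$, the functions $P_{X_k}(q\varphi)$ and $\frac{\mathrm d}{\mathrm dq}P_{X_k}(q\varphi)$ converge uniformly, as $k\to\infty$, to $P_\Sigma(q\varphi)$ and $\frac{\mathrm d}{\mathrm dq}P_\Sigma(q\varphi)$ respectively. -/

import Mathlib

open Filter Topology Set
open scoped NNReal ENNReal

namespace WaveletShift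

/-- The symbolic space `{0,1}^ℕ`; the letter `t_{i+1}` of the infinite word `t` is `t i`. -/
abbrev Seq : Type := ℕ → Fin 2

/-- Words of length `n`. -/
abbrev Word (n : ℕ) : Type := Fin n → Fin 2

/-- The standard metric: `ρ(s,t) = 2^{-n}`, with `n` the length of the longest common prefix of
`s ≠ t`. -/
noncomputable instance instMetricSpaceSeq : MetricSpace Seq := PiNat.metricSpace

/-- The left shift. -/
def shift (t : Seq) : Seq := fun i => t (i + 1)

/-- The prefix `t|_n`. -/
def pref (n : ℕ) (t : Seq) : Word n := fun i => t i

/-- The cylinder `[w]`. -/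
def cyl {n : ℕ} (w : Word n) : Set Seq := {t | pref n t = w}

/-- `λ(w) = ∑_{i=1}^{n} w_i 2^{-i}`. -/
noncomputable def lam {n : ℕ} (w : Word n) : ℝ :=
  ∑ i : Fin n, ((w i : ℕ) : ℝ) * (1 / 2) ^ ((i : ℕ) + 1)

/-- The sum over the words `w` of length `n` whose cylinder meets `X`, of
`exp (max_{t ∈ [w]} S_n φ (t))`. -/
noncomputable def partitionSum (X : Set Seq) (φ : Seq → ℝ) (n : ℕ) : ℝ :=
  open Classical in
  ∑ w : Word n with (cyl w ∩ X).Nonempty, Real.exp (sSup (birkhoffSum shift φ n '' cyl w))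

/-- The sequence whose limit is the topological pressure. -/
noncomputable def pressureSeq (X : Set Seq) (φ : Seq → ℝ) (n : ℕ) : ℝ :=
  (1 / (n : ℝ)) * Real.log (partitionSum X φ n)

/-- The topological pressure `P_X(φ)`. -/
noncomputable def pressure (X : Set Seq) (φ : Seq → ℝ) : ℝ :=
  limUnder atTop (pressureSeq X φ)

/-- The upper box-counting dimension: the limsup as `δ → 0+` of `log N_δ(X) / (-log δ)`, where
`N_δ(X)` is the least number of closed balls of radius `δ` centred in `X` that cover `X`. -/
noncomputable def upperBoxDim {E : Type*} [PseudoEMetricSpace E] (X : Set E) : EReal :=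
  limsup (fun δ : ℝ≥0 =>
    ENNReal.log (Metric.coveringNumber δ X : ℝ≥0∞) / ((-Real.log (δ : ℝ) : ℝ) : EReal)) (𝓝[>] 0)

/-- The subshift of finite type with admissible set `A` of words of length `n`. -/
def sft {n : ℕ} (A : Set (Word n)) : Set Seq := {t | ∀ m : ℕ, pref n (shift^[m] t) ∈ A}

/-- The transition relation on words of length `n - 1` induced by the admissible set `A`:
`a_1 ⋯ a_{n-1}` is followed by `a_2 ⋯ a_n` when `a_1 ⋯ a_n ∈ A`. -/
def Trans {n : ℕ} (A : Set (Word n)) (u v : Word (n - 1)) : Prop :=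
  ∃ a ∈ A, (∀ i : Fin (n - 1), u i = a ⟨i, by omega⟩) ∧
    (∀ i : Fin (n - 1), v i = a ⟨i + 1, by omega⟩)

/-- `X` is one of the topologically transitive pieces of `sft A`: the set of points all of whose
`(n-1)`-words lie in an irreducible class `C` of the transition relation, that is in the class of
all the words communicating (in at least one step) with a given word `u` that communicates with
itself. -/
def IsTransitivePiece {n : ℕ} (A : Set (Word n)) (X : Set Seq) : Prop :=
  ∃ (u : Word (n - 1)) (C : Set (Word (n - 1))),
    Relation.TransGen (Trans A) u u ∧
    C = {v | Relation.TransGen (Trans A) u v ∧ Relation.TransGen (Trans A) v u} ∧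
    X = {t ∈ sft A | ∀ m : ℕ, pref (n - 1) (shift^[m] t) ∈ C}

/-- `w = x|_k`: for `x ∈ [0,1)` the word with `λ(w) ≤ x < λ(w) + 2^{-k}`; for `x = 1` the word
`1⋯1`. -/
def IsDyadicPrefix {k : ℕ} (x : ℝ) (w : Word k) : Prop :=
  (x < 1 ∧ lam w ≤ x ∧ x < lam w + (1 / 2) ^ k) ∨ (x = 1 ∧ ∀ i, w i = 1)

/-- The set `λ(Σ_*)` of the values of `λ` on all finite words. -/
def lamRange : Set ℝ := {x | ∃ (n : ℕ) (w : Word n), lam w = x}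

/-- The words of length `k` forbidden by the point `x`: only `x|_k` if `x ∉ λ(Σ_*)`, and the words
`w` with `0 ≤ λ(x|_k) - λ(w) ≤ 2^{-k}` otherwise. -/
def forbiddenAt (k : ℕ) (x : ℝ) : Set (Word k) :=
  {w | ∃ v : Word k, IsDyadicPrefix x v ∧
    ((x ∉ lamRange ∧ w = v) ∨
      (x ∈ lamRange ∧ 0 ≤ lam v - lam w ∧ lam v - lam w ≤ (1 / 2) ^ k))}

/-- The zeros of `ψ` in `[0,1]`. -/
def zeros (ψ : ℝ → ℝ) : Set ℝ := {x | x ∈ Icc (0 : ℝ) 1 ∧ ψ x = 0}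

/-- The set of all words of length `k` that are not forbidden by a zero of `ψ`. -/
def admissible (ψ : ℝ → ℝ) (k : ℕ) : Set (Word k) := {w | ∀ x ∈ zeros ψ, w ∉ forbiddenAt k x}

/-- `X` is an admissible choice of the `k`-th zero-avoiding transitive subshift: a transitive piece
of the subshift of finite type avoiding the forbidden words of length `k`, of the same upper
box-counting dimension. -/
def IsZeroAvoidingPiece (ψ : ℝ → ℝ) (k : ℕ) (X : Set Seq) : Prop :=
  IsTransitivePiece (admissible ψ k) X ∧ upperBoxDim X = upperBoxDim (sft (admissible ψ k))

end WaveletShift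

/-! Convergence of the pressures. The number of forbidden words of length `k` is bounded
independently of `k` (`ncard_compl_admissible_le`), so with `M = k / 2` only `O(k)` words of length
`M` occur inside a forbidden word; call these bad and the others good. A window of length `k ≥ 2M`
in a concatenation of good words contains a whole good block, hence is not forbidden: `freeShift`
lies in `Y_k`. A piece showing only bad words would have too small a dimension, so a piece of full
dimension contains a good word, and through it communicates with every concatenation of good words
(`freeShift_subset_piece`). In the full shift one word of length `M` carries an exponentially small
share of the transfer operator sum (`pow_mul_exp_le_op_univ`). Dropping the bad words thus loses at
most half of the sum, and concatenating costs a bounded factor per block, which gives `M * P_Σ ≤ M *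
P_{X_k} + O(1)`, uniformly for bounded `q`. The reverse inequality `P_{X_k} ≤ P_Σ` is monotonicity.

Differentiability. Write `L_g` for the transfer operator of `g`. On a transitive Markov set a cone
of functions of controlled logarithmic variation is invariant, which makes `L_g^n 1` comparable to
`exp (n * P(g))` with a constant uniform over a class of potentials (`exists_pressure_bounds`). In
particular `q ↦ P(q φ)` is convex, and only kinks must be excluded. After subtracting the tangent of
right-hand slope, a kink means `p(0) = 0`, `p ≥ 0` with zero slope on the right, and `p(-t) ≥ γ * t`
on the left, where `p(h) = P(ζ + h η)`. Seen by `L_ζ` over a long block of length `n`, averages of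
`η` above `ε` are then rare, while averages below `-γ / 2` keep a proportion bounded below, whatever
the cone function at the start. So the block operator of `ζ + η / n` is at most `1 - d` times that
of `ζ` on the cone (`exists_blockOp_contraction`); iterating over blocks contradicts `p(1 / n) ≥ 0`
(`false_of_kink`). Blocks have variable length, from `n` to `n + R`, because transitivity does not
include aperiodicity.

Derivatives. Locally uniform convergence of convex differentiable functions to a differentiable
limit forces locally uniform convergence of the derivatives, by comparison with difference
quotients. -/

namespace WaveletShift

/-! ### Shift, splicing and Birkhoff sums -/

/-- The sequences `x` and `y` have the same first `n` letters. -/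
def Agree (n : ℕ) (x y : Seq) : Prop := ∀ i < n, x i = y i

/-- The first `n` letters of `y`, followed by `x`. -/
def splice (n : ℕ) (y x : Seq) : Seq := fun i => if i < n then y i else x (i - n)

/-- The word `w`, followed by `x`. -/
def app {n : ℕ} (w : Word n) (x : Seq) : Seq :=
  fun i => if h : i < n then w ⟨i, h⟩ else x (i - n)

theorem iterate_shift_apply (n : ℕ) (x : Seq) (i : ℕ) : shift^[n] x i = x (i + n) := by
  induction n generalizing x with
  | zero => rfl
  | succ n ih => rw [Function.iterate_succ_apply, ih]; simp only [shift]; congr 1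

theorem Agree.symm {n : ℕ} {x y : Seq} (h : Agree n x y) : Agree n y x :=
  fun i hi => (h i hi).symm

theorem Agree.trans {n : ℕ} {x y z : Seq} (h : Agree n x y) (h' : Agree n y z) : Agree n x z :=
  fun i hi => (h i hi).trans (h' i hi)

theorem Agree.mono {m n : ℕ} {x y : Seq} (h : Agree n x y) (hmn : m ≤ n) : Agree m x y :=
  fun i hi => h i (hi.trans_le hmn)

theorem Agree.shift_iterate {m n : ℕ} {x y : Seq} (h : Agree (m + n) x y) :
    Agree m (shift^[n] x) (shift^[n] y) := by
  intro i hi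
  rw [iterate_shift_apply, iterate_shift_apply]
  exact h _ (by omega)

theorem agree_iff_pref_eq {n : ℕ} {x y : Seq} : Agree n x y ↔ pref n x = pref n y := by
  constructor
  · intro h; funext i; exact h i i.2
  · intro h i hi; exact congrFun h ⟨i, hi⟩

theorem shift_splice (n : ℕ) (y x : Seq) : shift^[n] (splice n y x) = x := by
  funext i
  rw [iterate_shift_apply]
  simp [splice]

theorem splice_agree (n : ℕ) (y x : Seq) : Agree n (splice n y x) y := by
  intro i hi
  simp [splice, hi]

theorem splice_self (n : ℕ) (y : Seq) : splice n y (shift^[n] y) = y := by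
  funext i
  simp only [splice, iterate_shift_apply]
  split_ifs with h
  · rfl
  · congr 1; omega

theorem splice_agree_add {n m : ℕ} {y x : Seq} (h : Agree m (shift^[n] y) x) :
    Agree (n + m) (splice n y x) y := by
  intro i hi
  by_cases hin : i < n
  · exact splice_agree n y x i hin
  · have := h (i - n) (by omega)
    rw [iterate_shift_apply] at this
    simp only [splice, hin, if_false]
    rw [← this]; congr 1; omega

theorem splice_splice (n : ℕ) (y x x' : Seq) : splice n (splice n y x) x' = splice n y x' := by
  funext i
  by_cases h : i < n <;> simp [splice, h]

theorem eq_of_agree_of_shift_eq {n : ℕ} {x y : Seq} (h : Agree n x y)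
    (h' : shift^[n] x = shift^[n] y) : x = y := by
  funext i
  by_cases hi : i < n
  · exact h i hi
  · have := congrFun h' (i - n)
    rw [iterate_shift_apply, iterate_shift_apply] at this
    rwa [Nat.sub_add_cancel (by omega)] at this

theorem shift_app {n : ℕ} (w : Word n) (x : Seq) : shift^[n] (app w x) = x := by
  funext i
  rw [iterate_shift_apply]
  simp [app]

theorem pref_app {n : ℕ} (w : Word n) (x : Seq) : pref n (app w x) = w := by
  funext i
  simp [pref, app]

theorem app_pref_shift (n : ℕ) (y : Seq) : app (pref n y) (shift^[n] y) = y :=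
  eq_of_agree_of_shift_eq (agree_iff_pref_eq.2 (pref_app _ _)) (shift_app _ _)

/-- `g` is bounded by `C`, and varies by at most `C * θ ^ m` on cylinders of length `m`. -/
structure Regular (g : Seq → ℝ) (C θ : ℝ) : Prop where
  bound : ∀ x, |g x| ≤ C
  var : ∀ (m : ℕ) (x y : Seq), Agree m x y → |g x - g y| ≤ C * θ ^ m

theorem Regular.nonneg {g : Seq → ℝ} {C θ : ℝ} (h : Regular g C θ) : 0 ≤ C :=
  (abs_nonneg _).trans (h.bound 0)

theorem Regular.mono {g : Seq → ℝ} {C C' θ : ℝ} (h : Regular g C θ) (hC : C ≤ C') (hθ : 0 ≤ θ) :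
    Regular g C' θ :=
  ⟨fun x => (h.bound x).trans hC, fun m x y hxy => (h.var m x y hxy).trans (by gcongr)⟩

theorem Regular.add {g g' : Seq → ℝ} {C C' θ : ℝ} (h : Regular g C θ) (h' : Regular g' C' θ) :
    Regular (fun x => g x + g' x) (C + C') θ := by
  refine ⟨fun x => (abs_add_le _ _).trans (add_le_add (h.bound x) (h'.bound x)), ?_⟩
  intro m x y hxy
  have e : g x + g' x - (g y + g' y) = (g x - g y) + (g' x - g' y) := by ring
  rw [e, add_mul]
  exact (abs_add_le _ _).trans (add_le_add (h.var m x y hxy) (h'.var m x y hxy))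

theorem Regular.const_mul {g : Seq → ℝ} {C θ : ℝ} (h : Regular g C θ) (q : ℝ) :
    Regular (fun x => q * g x) (|q| * C) θ := by
  refine ⟨fun x => by rw [abs_mul]; gcongr; exact h.bound x, ?_⟩
  intro m x y hxy
  rw [← mul_sub, abs_mul, mul_assoc]
  gcongr
  exact h.var m x y hxy

theorem regular_const (c θ : ℝ) (hθ : 0 ≤ θ) : Regular (fun _ => c) |c| θ :=
  ⟨fun _ => le_rfl, fun m x y _ => by simp; positivity⟩

theorem Regular.abs_birkhoffSum_le {g : Seq → ℝ} {C θ : ℝ} (h : Regular g C θ) (n : ℕ) (x : Seq) :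
    |birkhoffSum shift g n x| ≤ n * C := by
  refine (Finset.abs_sum_le_sum_abs _ _).trans ?_
  refine (Finset.sum_le_sum fun i _ => h.bound _).trans ?_
  simp

/-- Bounded distortion of Birkhoff sums. -/
theorem Regular.birkhoffSum_sub_le {g : Seq → ℝ} {C θ B : ℝ} (h : Regular g C θ) (hθ0 : 0 ≤ θ)
    (hθ1 : θ ≤ 1) (hB : C ≤ B * (1 - θ)) (m n : ℕ) {x y : Seq} (hxy : Agree (n + m) x y) :
    |birkhoffSum shift g n x - birkhoffSum shift g n y| ≤ B * θ ^ m * (1 - θ ^ n) := by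
  -- The factor `1 - θ ^ n` of the geometric sum is kept: it makes the cone exactly invariant in
  -- `IsTransitiveMarkov.inCone_op`.
  induction n generalizing x y with
  | zero => simp
  | succ n ih =>
    rw [birkhoffSum_succ', birkhoffSum_succ']
    have h1 := ih (x := shift x) (y := shift y)
      (Agree.shift_iterate (m := n + m) (n := 1) (hxy.mono (by omega)))
    have h2 := h.var _ x y hxy
    have h3 : C * θ ^ (n + 1 + m) ≤ B * (1 - θ) * θ ^ (n + m) := by
      have : θ ^ (n + 1 + m) ≤ θ ^ (n + m) := pow_le_pow_of_le_one hθ0 hθ1 (by omega)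
      exact mul_le_mul hB this (by positivity) (h.nonneg.trans hB)
    have e : g x + birkhoffSum shift g n (shift x) - (g y + birkhoffSum shift g n (shift y))
      = (g x - g y) + (birkhoffSum shift g n (shift x) - birkhoffSum shift g n (shift y)) := by ring
    rw [e]
    refine (abs_add_le _ _).trans ((add_le_add (h2.trans h3) h1).trans (le_of_eq ?_))
    rw [pow_add, pow_succ]; ring

theorem Regular.birkhoffSum_sub_le_const {g : Seq → ℝ} {C θ B : ℝ} (h : Regular g C θ)
    (hθ0 : 0 ≤ θ) (hθ1 : θ ≤ 1) (hB0 : 0 ≤ B) (hB : C ≤ B * (1 - θ)) (n : ℕ) {x y : Seq}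
    (hxy : Agree n x y) : |birkhoffSum shift g n x - birkhoffSum shift g n y| ≤ B := by
  refine (h.birkhoffSum_sub_le hθ0 hθ1 hB 0 n hxy).trans ?_
  have : 0 ≤ θ ^ n := by positivity
  rw [pow_zero, mul_one]
  nlinarith

/-! ### The transfer operator -/

/-- The points of `X` mapped to `x` by the `n`-th iterate of the shift. -/
noncomputable def pre (X : Set Seq) (n : ℕ) (x : Seq) : Finset Seq :=
  open Classical in {y ∈ (Finset.univ : Finset (Word n)).image (fun w => app w x) | y ∈ X}

theorem mem_pre {X : Set Seq} {n : ℕ} {x y : Seq} : y ∈ pre X n x ↔ y ∈ X ∧ shift^[n] y = x := by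
  classical
  simp only [pre, Finset.mem_filter, Finset.mem_image, Finset.mem_univ, true_and]
  constructor
  · rintro ⟨⟨w, rfl⟩, h⟩
    exact ⟨h, shift_app _ _⟩
  · rintro ⟨h, rfl⟩
    exact ⟨⟨pref n y, app_pref_shift n y⟩, h⟩

theorem card_pre_le (X : Set Seq) (n : ℕ) (x : Seq) : (pre X n x).card ≤ 2 ^ n := by
  classical
  refine (Finset.card_filter_le _ _).trans (Finset.card_image_le.trans ?_)
  simp

/-- The `n`-th iterate of the transfer operator of the potential `g` on `X`. -/
noncomputable def op (X : Set Seq) (g : Seq → ℝ) (n : ℕ) (f : Seq → ℝ) (x : Seq) : ℝ :=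
  ∑ y ∈ pre X n x, Real.exp (birkhoffSum shift g n y) * f y

theorem iterate_shift_mem {X : Set Seq} (hX : ∀ x ∈ X, shift x ∈ X) (n : ℕ) {x : Seq}
    (hx : x ∈ X) : shift^[n] x ∈ X := by
  induction n with
  | zero => exact hx
  | succ n ih => rw [Function.iterate_succ_apply']; exact hX _ ih

/-- Preimages under `shift^[m + n]` are grouped by their image under `shift^[m]`, which stays in `X`
by forward invariance. -/
theorem op_add {X : Set Seq} (hX : ∀ x ∈ X, shift x ∈ X) (g : Seq → ℝ) (m n : ℕ) (f : Seq → ℝ)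
    (x : Seq) : op X g (m + n) f x = op X g n (op X g m f) x := by
  classical
  have hmaps : ∀ y ∈ pre X (m + n) x, shift^[m] y ∈ pre X n x := by
    intro y hy
    rw [mem_pre] at hy ⊢
    refine ⟨iterate_shift_mem hX m hy.1, ?_⟩
    rw [← Function.iterate_add_apply, add_comm n m]; exact hy.2
  unfold op
  rw [← Finset.sum_fiberwise_of_maps_to hmaps]
  refine Finset.sum_congr rfl fun z hz => ?_
  rw [Finset.mul_sum]
  have : {y ∈ pre X (m + n) x | shift^[m] y = z} = pre X m z := by
    ext y
    simp only [Finset.mem_filter, mem_pre]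
    rw [mem_pre] at hz
    constructor
    · rintro ⟨⟨h1, -⟩, h2⟩; exact ⟨h1, h2⟩
    · rintro ⟨h1, h2⟩
      refine ⟨⟨h1, ?_⟩, h2⟩
      rw [add_comm, Function.iterate_add_apply, h2]; exact hz.2
  rw [this]
  refine Finset.sum_congr rfl fun y hy => ?_
  rw [birkhoffSum_add, Real.exp_add, (mem_pre.1 hy).2]; ring

theorem op_mono {X : Set Seq} (g : Seq → ℝ) (n : ℕ) {f f' : Seq → ℝ} (h : ∀ y ∈ X, f y ≤ f' y)
    (x : Seq) : op X g n f x ≤ op X g n f' x :=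
  Finset.sum_le_sum fun y hy => mul_le_mul_of_nonneg_left (h y (mem_pre.1 hy).1) (Real.exp_nonneg _)

theorem op_nonneg {X : Set Seq} (g : Seq → ℝ) (n : ℕ) {f : Seq → ℝ} (h : ∀ y ∈ X, 0 ≤ f y)
    (x : Seq) : 0 ≤ op X g n f x :=
  Finset.sum_nonneg fun y hy => mul_nonneg (Real.exp_nonneg _) (h y (mem_pre.1 hy).1)

theorem op_const_mul (X : Set Seq) (g : Seq → ℝ) (n : ℕ) (f : Seq → ℝ) (c : ℝ) (x : Seq) :
    op X g n (fun y => c * f y) x = c * op X g n f x := by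
  unfold op
  rw [Finset.mul_sum]
  exact Finset.sum_congr rfl fun y _ => by ring

theorem op_sum (X : Set Seq) (g : Seq → ℝ) (n : ℕ) {ι : Type*} (s : Finset ι) (f : ι → Seq → ℝ)
    (x : Seq) : op X g n (fun y => ∑ i ∈ s, f i y) x = ∑ i ∈ s, op X g n (f i) x := by
  unfold op
  rw [Finset.sum_comm]
  exact Finset.sum_congr rfl fun y _ => by rw [Finset.mul_sum]

theorem op_zero_apply {X : Set Seq} (g : Seq → ℝ) (f : Seq → ℝ) {x : Seq} (hx : x ∈ X) :
    op X g 0 f x = f x := by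
  have : pre X 0 x = {x} := by
    ext y
    simp only [mem_pre, Function.iterate_zero, id, Finset.mem_singleton]
    exact ⟨fun h => h.2, fun h => ⟨h ▸ hx, h⟩⟩
  simp [op, this, birkhoffSum]

theorem le_op {X : Set Seq} (g : Seq → ℝ) (n : ℕ) {f : Seq → ℝ} (h : ∀ y ∈ X, 0 ≤ f y)
    {x y : Seq} (hy : y ∈ X) (hyx : shift^[n] y = x) :
    Real.exp (birkhoffSum shift g n y) * f y ≤ op X g n f x :=
  Finset.single_le_sum (f := fun y => Real.exp (birkhoffSum shift g n y) * f y)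
    (fun y hy => mul_nonneg (Real.exp_nonneg _) (h y (mem_pre.1 hy).1)) (mem_pre.2 ⟨hy, hyx⟩)

theorem op_one_le {X : Set Seq} {g : Seq → ℝ} {C θ : ℝ} (hg : Regular g C θ) (n : ℕ) (x : Seq) :
    op X g n 1 x ≤ (2 * Real.exp C) ^ n := by
  unfold op
  calc _ ≤ ∑ y ∈ pre X n x, Real.exp C ^ n := by
        refine Finset.sum_le_sum fun y _ => ?_
        rw [Pi.one_apply, mul_one, ← Real.exp_nat_mul]
        exact Real.exp_le_exp.2 ((le_abs_self _).trans (hg.abs_birkhoffSum_le n y))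
    _ = (pre X n x).card * Real.exp C ^ n := by simp
    _ ≤ (2 ^ n : ℕ) * Real.exp C ^ n := by
        gcongr
        exact card_pre_le X n x
    _ = _ := by rw [mul_pow]; push_cast; rfl

/-! ### Transitive Markov sets and the invariant cone -/

/-- Shift-invariant sets with the Markov property with memory `m`, whose states are joined by paths
of length at most `R`. -/
structure IsTransitiveMarkov (m R : ℕ) (X : Set Seq) : Prop where
  nonempty : X.Nonempty
  shift_mem : ∀ x ∈ X, shift x ∈ X
  splice_mem : ∀ (n : ℕ), ∀ y ∈ X, ∀ x ∈ X, Agree m (shift^[n] y) x → splice n y x ∈ X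
  link : ∀ x ∈ X, ∀ y ∈ X, ∃ r ≤ R, ∃ z ∈ X, Agree m z y ∧ shift^[r] z = x

/-- The cone of nonnegative functions on `X` with logarithmic variation at most `B * θ ^ j` on
cylinders of length `j ≥ m`. -/
structure InCone (X : Set Seq) (m : ℕ) (θ B : ℝ) (f : Seq → ℝ) : Prop where
  nonneg : ∀ x ∈ X, 0 ≤ f x
  le : ∀ j ≥ m, ∀ x ∈ X, ∀ x' ∈ X, Agree j x x' → f x ≤ Real.exp (B * θ ^ j) * f x'

theorem inCone_one {X : Set Seq} {m : ℕ} {θ B : ℝ} (hθ : 0 ≤ θ) (hB : 0 ≤ B) :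
    InCone X m θ B 1 := by
  refine ⟨fun _ _ => zero_le_one, fun j _ x _ x' _ _ => ?_⟩
  simp only [Pi.one_apply, mul_one]
  exact Real.one_le_exp (by positivity)

theorem InCone.sum {X : Set Seq} {m : ℕ} {θ B : ℝ} {ι : Type*} {s : Finset ι} {f : ι → Seq → ℝ}
    (h : ∀ i ∈ s, InCone X m θ B (f i)) : InCone X m θ B (fun x => ∑ i ∈ s, f i x) := by
  refine ⟨fun x hx => Finset.sum_nonneg fun i hi => (h i hi).nonneg x hx, ?_⟩
  intro j hj x hx x' hx' hxx'
  rw [Finset.mul_sum]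
  exact Finset.sum_le_sum fun i hi => (h i hi).le j hj x hx x' hx' hxx'

/-- By the Markov property, exchanging the tail `x` for `x'` is a bijection between their preimages.
The distortion `B * θ ^ j * (1 - θ ^ n)` along a branch and the variation `B * θ ^ (n + j)` of `f`
at its start add up to exactly `B * θ ^ j`. -/
theorem IsTransitiveMarkov.inCone_op {m R : ℕ} {X : Set Seq} (hX : IsTransitiveMarkov m R X)
    {g : Seq → ℝ} {C θ B : ℝ} (hg : Regular g C θ) (hθ0 : 0 ≤ θ) (hθ1 : θ ≤ 1)
    (hB : C ≤ B * (1 - θ)) {f : Seq → ℝ} (hf : InCone X m θ B f) (n : ℕ) :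
    InCone X m θ B (op X g n f) := by
  refine ⟨fun x _ => op_nonneg g n hf.nonneg x, ?_⟩
  intro j hj x hx x' hx' hxx'
  have key : op X g n f x' = ∑ y ∈ pre X n x,
      Real.exp (birkhoffSum shift g n (splice n y x')) * f (splice n y x') := by
    refine (Finset.sum_nbij' (fun y => splice n y x') (fun y => splice n y x) ?_ ?_ ?_ ?_ ?_).symm
    · intro y hy
      rw [mem_pre] at hy ⊢
      refine ⟨hX.splice_mem n y hy.1 x' hx' ?_, shift_splice _ _ _⟩
      rw [hy.2]; exact hxx'.mono hj
    · intro y hy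
      rw [mem_pre] at hy ⊢
      refine ⟨hX.splice_mem n y hy.1 x hx ?_, shift_splice _ _ _⟩
      rw [hy.2]; exact hxx'.symm.mono hj
    · intro y hy
      rw [mem_pre] at hy
      simp only [splice_splice]
      rw [← hy.2, splice_self]
    · intro y hy
      rw [mem_pre] at hy
      simp only [splice_splice]
      rw [← hy.2, splice_self]
    · intro y _; rfl
  rw [key, Finset.mul_sum]
  refine Finset.sum_le_sum fun y hy => ?_
  rw [mem_pre] at hy
  have ha : Agree j (shift^[n] y) x' := by rw [hy.2]; exact hxx'
  have hs : Agree (n + j) y (splice n y x') := (splice_agree_add ha).symm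
  have hsX : splice n y x' ∈ X := hX.splice_mem n y hy.1 x' hx' (ha.mono hj)
  have h1 := hf.le (n + j) (by omega) y hy.1 _ hsX hs
  have h2 := (abs_le.1 (hg.birkhoffSum_sub_le hθ0 hθ1 hB j n hs)).2
  have h3 : Real.exp (birkhoffSum shift g n y) ≤
      Real.exp (B * θ ^ j * (1 - θ ^ n)) * Real.exp (birkhoffSum shift g n (splice n y x')) := by
    rw [← Real.exp_add]; exact Real.exp_le_exp.2 (by linarith)
  calc Real.exp (birkhoffSum shift g n y) * f y
      ≤ (Real.exp (B * θ ^ j * (1 - θ ^ n)) * Real.exp (birkhoffSum shift g n (splice n y x'))) *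
        (Real.exp (B * θ ^ (n + j)) * f (splice n y x')) :=
        mul_le_mul h3 h1 (hf.nonneg _ hy.1) (by positivity)
    _ = (Real.exp (B * θ ^ j * (1 - θ ^ n)) * Real.exp (B * θ ^ (n + j))) *
        (Real.exp (birkhoffSum shift g n (splice n y x')) * f (splice n y x')) := by ring
    _ = _ := by
        rw [← Real.exp_add]; congr 2; rw [pow_add]; ring

end WaveletShift

namespace WaveletShift

/-! ### Pressure and uniform estimates for the transfer operator -/

/-- A sequence which is additive up to `K` is linear up to `K`. -/
theorem exists_linear_approx {b : ℕ → ℝ} {K : ℝ} (h : ∀ m n, |b (m + n) - b m - b n| ≤ K) :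
    ∃ P : ℝ, ∀ n, |b n - n * P| ≤ K := by
  have hK : 0 ≤ K := (abs_nonneg _).trans (h 0 0)
  have hlin : ∀ n : ℕ, |b (n + 1) - (n + 1) * b 1| ≤ n * K := by
    intro n
    induction n with
    | zero => simp
    | succ n ih =>
      have h1 := h (n + 1) 1
      rw [abs_le] at h1 ih ⊢
      push_cast
      constructor <;> nlinarith [h1.1, h1.2, ih.1, ih.2]
  -- Fekete's lemma is applied to `b + K` and to `K - b`. Their limits are opposite, and each limit
  -- is also a lower bound of its sequence, which yields the two-sided estimate.
  have hs : Subadditive (fun n => b n + K) := fun m n => by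
    have := (abs_le.1 (h m n)).2; simp only; linarith
  have hs' : Subadditive (fun n => K - b n) := fun m n => by
    have := (abs_le.1 (h m n)).1; simp only; linarith
  have hdiv : ∀ n : ℕ, |b n / n| ≤ |b 1| + K := by
    intro n
    rcases n with _ | n
    · simp; positivity
    have hn : (0 : ℝ) < ((n + 1 : ℕ) : ℝ) := by positivity
    rw [abs_div, abs_of_pos hn, div_le_iff₀ hn]
    have h1 := hlin n
    have h2 : |b (n + 1)| ≤ |b (n + 1) - (n + 1) * b 1| + |((n : ℝ) + 1) * b 1| := by
      have := abs_add_le (b (n + 1) - (n + 1) * b 1) (((n : ℝ) + 1) * b 1)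
      simpa using this
    rw [abs_mul, abs_of_nonneg (by positivity : (0 : ℝ) ≤ (n : ℝ) + 1)] at h2
    push_cast
    nlinarith
  have hbd : BddBelow (range fun n : ℕ => (b n + K) / n) := by
    refine ⟨-(|b 1| + K), ?_⟩
    rintro _ ⟨n, rfl⟩
    have h1 := (abs_le.1 (hdiv n)).1
    have h2 : 0 ≤ K / n := by positivity
    simp only [add_div]; linarith
  have hbd' : BddBelow (range fun n : ℕ => (K - b n) / n) := by
    refine ⟨-(|b 1| + K), ?_⟩
    rintro _ ⟨n, rfl⟩
    have h1 := (abs_le.1 (hdiv n)).2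
    have h2 : 0 ≤ K / n := by positivity
    simp only [sub_div]; linarith
  have ht := hs.tendsto_lim hbd
  have ht' := hs'.tendsto_lim hbd'
  have hKn : Tendsto (fun n : ℕ => (2 * K) / (n : ℝ)) atTop (𝓝 0) :=
    tendsto_const_div_atTop_nhds_zero_nat _
  have hsum : hs.lim + hs'.lim = 0 := by
    refine tendsto_nhds_unique (ht.add ht') (hKn.congr fun n => ?_)
    rw [← add_div]; congr 1; ring
  refine ⟨hs.lim, fun n => ?_⟩
  rcases n.eq_zero_or_pos with rfl | hn
  · have := h 0 0
    simp at this ⊢; exact this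
  have hn' : (0 : ℝ) < n := by exact_mod_cast hn
  have h1 := hs.lim_le_div hbd hn.ne'
  have h2 := hs'.lim_le_div hbd' hn.ne'
  rw [le_div_iff₀ hn'] at h1 h2
  rw [abs_le]
  constructor <;> nlinarith

/-- The sum of the first `R + 1` iterates of the transfer operator. -/
noncomputable def sumOp (X : Set Seq) (g : Seq → ℝ) (R : ℕ) (f : Seq → ℝ) (x : Seq) : ℝ :=
  ∑ r ∈ Finset.range (R + 1), op X g r f x

/-- A common bound for the functions `sumOp X g R 1`. -/
noncomputable def sumBound (C : ℝ) (R : ℕ) : ℝ :=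
  ∑ r ∈ Finset.range (R + 1), (2 * Real.exp C) ^ r

theorem one_le_sumBound (C : ℝ) (R : ℕ) : 1 ≤ sumBound C R := by
  unfold sumBound
  rw [Finset.sum_range_succ']
  have : 0 ≤ ∑ k ∈ Finset.range R, (2 * Real.exp C) ^ (k + 1) :=
    Finset.sum_nonneg fun _ _ => by positivity
  simpa using this

theorem sumOp_mono {X : Set Seq} (g : Seq → ℝ) (R : ℕ) {f f' : Seq → ℝ} (h : ∀ y ∈ X, f y ≤ f' y)
    (x : Seq) : sumOp X g R f x ≤ sumOp X g R f' x :=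
  Finset.sum_le_sum fun r _ => op_mono g r h x

theorem sumOp_le {X : Set Seq} {g : Seq → ℝ} {C θ : ℝ} (hg : Regular g C θ) (R : ℕ)
    {f : Seq → ℝ} {M : ℝ} (hM : 0 ≤ M) (h : ∀ y ∈ X, f y ≤ M) (x : Seq) :
    sumOp X g R f x ≤ sumBound C R * M := by
  unfold sumOp sumBound
  rw [Finset.sum_mul]
  refine Finset.sum_le_sum fun r _ => ?_
  calc op X g r f x ≤ op X g r (fun y => M * (1 : Seq → ℝ) y) x :=
        op_mono g r (fun y hy => by simpa using h y hy) x
    _ = M * op X g r 1 x := op_const_mul _ _ _ _ _ _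
    _ ≤ M * (2 * Real.exp C) ^ r := by gcongr; exact op_one_le hg r x
    _ = _ := mul_comm _ _

section Estimates

variable {m R : ℕ} {X : Set Seq} {g : Seq → ℝ} {C θ B : ℝ}

theorem IsTransitiveMarkov.inCone_sumOp (hX : IsTransitiveMarkov m R X) (hg : Regular g C θ)
    (hθ0 : 0 ≤ θ) (hθ1 : θ ≤ 1) (hB : C ≤ B * (1 - θ)) {f : Seq → ℝ}
    (hf : InCone X m θ B f) (R' : ℕ) : InCone X m θ B (sumOp X g R' f) :=
  InCone.sum fun r _ => hX.inCone_op hg hθ0 hθ1 hB hf r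

/-- Values of a function in the cone at different points are compared by transitivity. -/
theorem IsTransitiveMarkov.le_sumOp (hX : IsTransitiveMarkov m R X) (hg : Regular g C θ)
    (hθ0 : 0 ≤ θ) (hθ1 : θ ≤ 1) (hB0 : 0 ≤ B) {f : Seq → ℝ}
    (hf : InCone X m θ B f) {x x' : Seq} (hx : x ∈ X) (hx' : x' ∈ X) :
    f x ≤ Real.exp (B + R * C) * sumOp X g R f x' := by
  -- `z` is a preimage of `x'` close to `x`: the cone condition moves `f` from `x` to `z`, and `z`
  -- is one term of `op X g r f x'`. The length `r` depends on the points, hence the sum over `r ≤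
  -- R`.
  obtain ⟨r, hr, z, hz, hzx, hzx'⟩ := hX.link x' hx' x hx
  have h1 : f x ≤ Real.exp B * f z := by
    refine (hf.le m le_rfl x hx z hz hzx.symm).trans ?_
    refine mul_le_mul_of_nonneg_right (Real.exp_le_exp.2 ?_) (hf.nonneg z hz)
    have : θ ^ m ≤ 1 := pow_le_one₀ hθ0 hθ1
    nlinarith
  have h2 : Real.exp (birkhoffSum shift g r z) * f z ≤ op X g r f x' := le_op g r hf.nonneg hz hzx'
  have h3 : op X g r f x' ≤ sumOp X g R f x' :=
    Finset.single_le_sum (f := fun r => op X g r f x')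
      (fun r _ => op_nonneg g r hf.nonneg x') (Finset.mem_range.2 (by omega))
  have h4 : 1 ≤ Real.exp (R * C) * Real.exp (birkhoffSum shift g r z) := by
    rw [← Real.exp_add]
    refine Real.one_le_exp ?_
    have h5 := (abs_le.1 (hg.abs_birkhoffSum_le r z)).1
    have h6 : (r : ℝ) * C ≤ R * C := by
      have := hg.nonneg
      gcongr
    linarith
  calc f x ≤ Real.exp B * f z := h1
    _ ≤ Real.exp B * ((Real.exp (R * C) * Real.exp (birkhoffSum shift g r z)) * f z) := by
        gcongr
        exact le_mul_of_one_le_left (hf.nonneg z hz) h4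
    _ = Real.exp (B + R * C) * (Real.exp (birkhoffSum shift g r z) * f z) := by
        rw [Real.exp_add]; ring
    _ ≤ _ := by gcongr; exact h2.trans h3

/-- Iterates of the operator commute, so the extra `r` steps can be applied to `1` first, where they
cost at most `(2 * exp C) ^ r`. -/
theorem IsTransitiveMarkov.sumOp_op_one_le (hX : IsTransitiveMarkov m R X) (hg : Regular g C θ)
    (n R' : ℕ) (x : Seq) : sumOp X g R' (op X g n 1) x ≤ sumBound C R' * op X g n 1 x := by
  unfold sumOp sumBound
  rw [Finset.sum_mul]
  refine Finset.sum_le_sum fun r _ => ?_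
  rw [← op_add hX.shift_mem, add_comm, op_add hX.shift_mem]
  calc op X g n (op X g r 1) x
      ≤ op X g n (fun y => (2 * Real.exp C) ^ r * (1 : Seq → ℝ) y) x :=
        op_mono g n (fun y _ => by simpa using op_one_le hg r y) x
    _ = _ := op_const_mul _ _ _ _ _ _

/-- A Harnack inequality: `op X g n 1` lies in the cone, so `le_sumOp` compares its values, and
commutation removes the sum over `r`. The constant is independent of `n`. -/
theorem IsTransitiveMarkov.op_one_le_mul (hX : IsTransitiveMarkov m R X) (hg : Regular g C θ)
    (hθ0 : 0 ≤ θ) (hθ1 : θ ≤ 1) (hB0 : 0 ≤ B) (hB : C ≤ B * (1 - θ)) (n : ℕ)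
    {x x' : Seq} (hx : x ∈ X) (hx' : x' ∈ X) :
    op X g n 1 x ≤ Real.exp (B + R * C) * sumBound C R * op X g n 1 x' := by
  refine (hX.le_sumOp hg hθ0 hθ1 hB0
    (hX.inCone_op hg hθ0 hθ1 hB (inCone_one hθ0 hB0) n) hx hx').trans ?_
  rw [mul_assoc]
  gcongr
  exact hX.sumOp_op_one_le hg n R x'

/-- The point `shift^[n] x` has the preimage `x` in `X`; the comparison of values carries positivity
back to `x`. -/
theorem IsTransitiveMarkov.op_one_pos (hX : IsTransitiveMarkov m R X) (hg : Regular g C θ)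
    (hθ0 : 0 ≤ θ) (hθ1 : θ ≤ 1) (hB0 : 0 ≤ B) (hB : C ≤ B * (1 - θ)) (n : ℕ)
    {x : Seq} (hx : x ∈ X) : 0 < op X g n 1 x := by
  have h1 : 0 < op X g n 1 (shift^[n] x) :=
    lt_of_lt_of_le (by simp only [Pi.one_apply, mul_one]; positivity)
      (le_op g n (f := 1) (fun _ _ => zero_le_one) hx rfl)
  have h2 := hX.op_one_le_mul hg hθ0 hθ1 hB0 hB n (iterate_shift_mem hX.shift_mem n hx) hx
  have h3 : 0 < Real.exp (B + R * C) * sumBound C R :=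
    mul_pos (Real.exp_pos _) (zero_lt_one.trans_le (one_le_sumBound _ _))
  exact (mul_pos_iff_of_pos_left h3).1 (h1.trans_le h2)

theorem bddAbove_birkhoffSum_cyl (hg : Regular g C θ) {n : ℕ} (w : Word n) :
    BddAbove (birkhoffSum shift g n '' cyl w) := by
  refine ⟨n * C, ?_⟩
  rintro _ ⟨y, -, rfl⟩
  exact (le_abs_self _).trans (hg.abs_birkhoffSum_le n y)

/-- Distinct preimages of one point lie in distinct cylinders, each of which meets `X`. -/
theorem op_one_le_partitionSum (hg : Regular g C θ) (n : ℕ) (x : Seq) :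
    op X g n 1 x ≤ partitionSum X g n := by
  classical
  unfold op partitionSum
  have hinj : Set.InjOn (pref n) (pre X n x : Set Seq) := by
    intro y hy y' hy' h
    have hy := mem_pre.1 hy
    have hy' := mem_pre.1 hy'
    exact eq_of_agree_of_shift_eq (agree_iff_pref_eq.2 h) (hy.2.trans hy'.2.symm)
  calc ∑ y ∈ pre X n x, Real.exp (birkhoffSum shift g n y) * (1 : Seq → ℝ) y
      ≤ ∑ y ∈ pre X n x, Real.exp (sSup (birkhoffSum shift g n '' cyl (pref n y))) := by
        refine Finset.sum_le_sum fun y _ => ?_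
        rw [Pi.one_apply, mul_one]
        exact Real.exp_le_exp.2 (le_csSup (bddAbove_birkhoffSum_cyl hg _) ⟨y, rfl, rfl⟩)
    _ = ∑ w ∈ (pre X n x).image (pref n), Real.exp (sSup (birkhoffSum shift g n '' cyl w)) :=
        (Finset.sum_image (f := fun w => Real.exp (sSup (birkhoffSum shift g n '' cyl w)))
          hinj).symm
    _ ≤ _ := by
        refine Finset.sum_le_sum_of_subset_of_nonneg ?_ fun _ _ _ => (Real.exp_pos _).le
        intro w hw
        obtain ⟨y, hy, rfl⟩ := Finset.mem_image.1 hw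
        simp only [Finset.mem_filter, Finset.mem_univ, true_and]
        exact ⟨y, rfl, (mem_pre.1 hy).1⟩

/-- Every `n`-word seen in `X` is prolonged by a link of length `r ≤ R` to a preimage of `x` under
`shift^[n + r]`. Sorting these preimages by prefix prevents double counting. -/
theorem IsTransitiveMarkov.partitionSum_le (hX : IsTransitiveMarkov m R X) (hg : Regular g C θ)
    (hθ0 : 0 ≤ θ) (hθ1 : θ ≤ 1) (hB0 : 0 ≤ B) (hB : C ≤ B * (1 - θ)) (n : ℕ)
    {x : Seq} (hx : x ∈ X) :
    partitionSum X g n ≤ Real.exp (2 * B + R * C) * sumBound C R * op X g n 1 x := by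
  classical
  set F : ℕ → Seq → ℝ := fun r y => Real.exp (birkhoffSum shift g (n + r) y) with hF
  have key : ∀ w : Word n, (cyl w ∩ X).Nonempty →
      Real.exp (sSup (birkhoffSum shift g n '' cyl w)) ≤ Real.exp (2 * B + R * C) *
        ∑ r ∈ Finset.range (R + 1), ∑ y ∈ pre X (n + r) x with pref n y = w, F r y := by
    rintro w ⟨y, hyw, hyX⟩
    obtain ⟨r, hr, z, hz, hzy, hzx⟩ := hX.link x hx _ (iterate_shift_mem hX.shift_mem n hyX)
    set v := splice n y z
    have hv : v ∈ X := hX.splice_mem n y hyX z hz hzy.symm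
    have hvx : shift^[n + r] v = x := by
      rw [add_comm, Function.iterate_add_apply, shift_splice, hzx]
    have hvw : pref n v = w := (agree_iff_pref_eq.1 (splice_agree n y z)).trans hyw
    have h1 : sSup (birkhoffSum shift g n '' cyl w) ≤ birkhoffSum shift g (n + r) v + B + R * C := by
      refine csSup_le ⟨_, y, hyw, rfl⟩ ?_
      rintro _ ⟨y', hy', rfl⟩
      have h2 := (abs_le.1 (hg.birkhoffSum_sub_le_const hθ0 hθ1 hB0 hB n
        (agree_iff_pref_eq.2 (Eq.trans hy' hvw.symm)))).2
      rw [birkhoffSum_add]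
      have h3 := (abs_le.1 (hg.abs_birkhoffSum_le r (shift^[n] v))).1
      have h4 : (r : ℝ) * C ≤ R * C := by
        have := hg.nonneg
        gcongr
      linarith
    calc _ ≤ Real.exp (2 * B + R * C) * F r v := by
          rw [hF, ← Real.exp_add]; exact Real.exp_le_exp.2 (by linarith)
      _ ≤ _ := by
          gcongr
          refine le_trans ?_ (Finset.single_le_sum
            (f := fun r => ∑ y ∈ pre X (n + r) x with pref n y = w, F r y)
            (fun r _ => Finset.sum_nonneg fun _ _ => (Real.exp_pos _).le)
            (Finset.mem_range.2 (Nat.lt_succ_of_le hr)))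
          exact Finset.single_le_sum (f := F r) (fun _ _ => (Real.exp_pos _).le)
            (Finset.mem_filter.2 ⟨mem_pre.2 ⟨hv, hvx⟩, hvw⟩)
  unfold partitionSum
  calc _ ≤ ∑ w : Word n, Real.exp (2 * B + R * C) *
        ∑ r ∈ Finset.range (R + 1), ∑ y ∈ pre X (n + r) x with pref n y = w, F r y := by
        rw [Finset.sum_filter]
        refine Finset.sum_le_sum fun w _ => ?_
        split_ifs with hw
        · exact key w hw
        · exact mul_nonneg (Real.exp_pos _).le (Finset.sum_nonneg fun _ _ =>
            Finset.sum_nonneg fun _ _ => (Real.exp_pos _).le)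
    _ = Real.exp (2 * B + R * C) * sumOp X g R (op X g n 1) x := by
        rw [← Finset.mul_sum, Finset.sum_comm]
        congr 1
        refine Finset.sum_congr rfl fun r _ => ?_
        rw [Finset.sum_fiberwise, ← op_add hX.shift_mem]
        simp [op, hF]
    _ ≤ _ := by
        rw [mul_assoc]
        gcongr
        exact hX.sumOp_op_one_le hg n R x

/-- The limits defining the pressure exist, and the iterates of the transfer operator grow as the
exponential of the pressure, uniformly for potentials with a given regularity. -/
theorem IsTransitiveMarkov.exists_pressure_bounds (hX : IsTransitiveMarkov m R X) (C : ℝ)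
    (hθ0 : 0 ≤ θ) (hθ1 : θ < 1) : ∃ c : ℝ, 1 ≤ c ∧ ∀ g : Seq → ℝ, Regular g C θ →
      Tendsto (pressureSeq X g) atTop (𝓝 (pressure X g)) ∧
      ∀ n : ℕ, ∀ x ∈ X, c⁻¹ * Real.exp (n * pressure X g) ≤ op X g n 1 x ∧
        op X g n 1 x ≤ c * Real.exp (n * pressure X g) := by
  by_cases hC : 0 ≤ C
  swap
  · exact ⟨1, le_rfl, fun g hg => absurd hg.nonneg hC⟩
  obtain ⟨x₀, hx₀⟩ := hX.nonempty
  set B : ℝ := C / (1 - θ) with hBdef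
  have h1θ : 0 < 1 - θ := by linarith
  have hB0 : 0 ≤ B := by positivity
  have hB : C ≤ B * (1 - θ) := by rw [hBdef, div_mul_cancel₀ _ h1θ.ne']
  set c₁ : ℝ := Real.exp (B + R * C) * sumBound C R with hc₁
  set c₂ : ℝ := Real.exp (2 * B + R * C) * sumBound C R with hc₂
  have hc₁1 : 1 ≤ c₁ := one_le_mul_of_one_le_of_one_le (Real.one_le_exp (by positivity))
    (one_le_sumBound _ _)
  have hc₂1 : 1 ≤ c₂ := one_le_mul_of_one_le_of_one_le (Real.one_le_exp (by positivity))
    (one_le_sumBound _ _)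
  have hc₁0 : 0 < c₁ := by linarith
  have hc₂0 : 0 < c₂ := by linarith
  -- The constant is fixed before `g`: perturbations `ζ + h * η`, and all `q` in a bounded range,
  -- are later treated with one constant.
  refine ⟨c₁ * c₁, one_le_mul_of_one_le_of_one_le hc₁1 hc₁1, fun g hg => ?_⟩
  have hpos : ∀ n, ∀ x ∈ X, 0 < op X g n 1 x := fun n x hx =>
    hX.op_one_pos hg hθ0 hθ1.le hB0 hB n hx
  have hcmp : ∀ n, ∀ x ∈ X, ∀ x' ∈ X, op X g n 1 x ≤ c₁ * op X g n 1 x' := fun n x hx x' hx' =>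
    hX.op_one_le_mul hg hθ0 hθ1.le hB0 hB n hx hx'
  have hup : ∀ k n, op X g (k + n) 1 x₀ ≤ c₁ * (op X g k 1 x₀ * op X g n 1 x₀) := by
    intro k n
    rw [op_add hX.shift_mem]
    refine (op_mono (f' := fun y => (c₁ * op X g k 1 x₀) * (1 : Seq → ℝ) y) g n
      (fun y hy => by simpa using hcmp k y hy x₀ hx₀) x₀).trans (le_of_eq ?_)
    rw [op_const_mul]; ring
  have hlow : ∀ k n, op X g k 1 x₀ * op X g n 1 x₀ ≤ c₁ * op X g (k + n) 1 x₀ := by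
    intro k n
    rw [op_add hX.shift_mem]
    have := op_mono (f := fun y => (op X g k 1 x₀) * (1 : Seq → ℝ) y)
      (f' := fun y => c₁ * op X g k 1 y) g n
      (fun y hy => by simpa using hcmp k x₀ hx₀ y hy) x₀
    rwa [op_const_mul, op_const_mul] at this
  set b : ℕ → ℝ := fun n => Real.log (op X g n 1 x₀) with hb
  obtain ⟨P, hP⟩ : ∃ P : ℝ, ∀ n, |b n - n * P| ≤ Real.log c₁ := by
    refine exists_linear_approx fun k n => ?_
    have e1 := Real.log_le_log (hpos _ x₀ hx₀) (hup k n)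
    have e2 := Real.log_le_log (mul_pos (hpos _ x₀ hx₀) (hpos _ x₀ hx₀)) (hlow k n)
    rw [Real.log_mul hc₁0.ne' (mul_pos (hpos _ x₀ hx₀) (hpos _ x₀ hx₀)).ne',
      Real.log_mul (hpos _ x₀ hx₀).ne' (hpos _ x₀ hx₀).ne'] at e1
    rw [Real.log_mul hc₁0.ne' (hpos _ x₀ hx₀).ne',
      Real.log_mul (hpos _ x₀ hx₀).ne' (hpos _ x₀ hx₀).ne'] at e2
    rw [abs_le]
    simp only [hb]
    constructor <;> linarith
  have htend : Tendsto (pressureSeq X g) atTop (𝓝 P) := by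
    rw [tendsto_iff_dist_tendsto_zero]
    have hz : Tendsto (fun n : ℕ => (Real.log c₁ + Real.log c₂) / (n : ℝ)) atTop (𝓝 0) :=
      tendsto_const_div_atTop_nhds_zero_nat _
    refine squeeze_zero' (Eventually.of_forall fun _ => dist_nonneg) ?_ hz
    filter_upwards [eventually_gt_atTop 0] with n hn
    have hn' : (0 : ℝ) < n := by exact_mod_cast hn
    have p1 := op_one_le_partitionSum (X := X) hg n x₀
    have p2 := hX.partitionSum_le hg hθ0 hθ1.le hB0 hB n hx₀
    have q1 := Real.log_le_log (hpos n x₀ hx₀) p1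
    have q2 := Real.log_le_log ((hpos n x₀ hx₀).trans_le p1) p2
    rw [Real.log_mul hc₂0.ne' (hpos n x₀ hx₀).ne'] at q2
    have q3 := abs_le.1 (hP n)
    have q4 : 0 ≤ Real.log c₂ := Real.log_nonneg hc₂1
    rw [Real.dist_eq]
    have e : pressureSeq X g n - P = (Real.log (partitionSum X g n) - n * P) / n := by
      unfold pressureSeq; field_simp
    rw [e, abs_div, abs_of_pos hn']
    gcongr
    rw [abs_le]
    simp only [hb] at q3
    constructor <;> linarith
  have hPeq : pressure X g = P := htend.limUnder_eq
  rw [hPeq]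
  refine ⟨htend, fun n x hx => ?_⟩
  have hlog : ∀ n : ℕ, c₁⁻¹ * Real.exp (n * P) ≤ op X g n 1 x₀ ∧
      op X g n 1 x₀ ≤ c₁ * Real.exp (n * P) := by
    intro n
    have q3 := abs_le.1 (hP n)
    simp only [hb] at q3
    rw [← Real.exp_log (hpos n x₀ hx₀)]
    nth_rw 1 [← Real.exp_log hc₁0]
    nth_rw 2 [← Real.exp_log hc₁0]
    rw [← Real.exp_neg, ← Real.exp_add, ← Real.exp_add]
    exact ⟨Real.exp_le_exp.2 (by linarith), Real.exp_le_exp.2 (by linarith)⟩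
  have r1 := hcmp n x hx x₀ hx₀
  have r2 := hcmp n x₀ hx₀ x hx
  constructor
  · rw [mul_inv, mul_assoc, inv_mul_le_iff₀ hc₁0]
    exact (hlog n).1.trans r2
  · rw [mul_assoc]
    exact r1.trans (mul_le_mul_of_nonneg_left (hlog n).2 hc₁0.le)

end Estimates

end WaveletShift

namespace WaveletShift

/-! ### Convexity and differentiability of the pressure -/

/-- A factor independent of `n` cannot offset an exponential gap; this discards multiplicative
constants whenever pressures are compared. -/
theorem le_of_exp_nat_mul_le {a b K : ℝ} (h : ∀ n : ℕ, Real.exp (n * a) ≤ K * Real.exp (n * b)) :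
    a ≤ b := by
  by_contra! hab
  have h' : ∀ n : ℕ, Real.exp (n * (a - b)) ≤ K := by
    intro n
    have := h n
    rw [← div_le_iff₀ (Real.exp_pos _), ← Real.exp_sub] at this
    rwa [mul_sub]
  obtain ⟨n, hn⟩ := exists_nat_gt (K / (a - b))
  rw [div_lt_iff₀ (by linarith)] at hn
  have := Real.add_one_le_exp (n * (a - b))
  linarith [h' n]

/-- Hölder's inequality, from the convexity of `exp` after normalising both sums to `1`. -/
theorem log_sum_exp_convex {ι : Type*} {s : Finset ι} (hs : s.Nonempty) (a b : ι → ℝ) {t u : ℝ}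
    (ht : 0 ≤ t) (hu : 0 ≤ u) (htu : t + u = 1) :
    ∑ i ∈ s, Real.exp (t * a i + u * b i) ≤
      Real.exp (t * Real.log (∑ i ∈ s, Real.exp (a i)) +
        u * Real.log (∑ i ∈ s, Real.exp (b i))) := by
  set A := ∑ i ∈ s, Real.exp (a i) with hA
  set D := ∑ i ∈ s, Real.exp (b i) with hD
  have hA0 : 0 < A := Finset.sum_pos (fun _ _ => Real.exp_pos _) hs
  have hD0 : 0 < D := Finset.sum_pos (fun _ _ => Real.exp_pos _) hs
  have key : ∀ i ∈ s, Real.exp (t * a i + u * b i) ≤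
      Real.exp (t * Real.log A + u * Real.log D) *
        (t * (Real.exp (a i) / A) + u * (Real.exp (b i) / D)) := by
    intro i _
    have h1 := convexOn_exp.2 (mem_univ (a i - Real.log A)) (mem_univ (b i - Real.log D)) ht hu htu
    simp only [smul_eq_mul, Real.exp_sub, Real.exp_log hA0, Real.exp_log hD0] at h1
    have e : t * a i + u * b i = (t * Real.log A + u * Real.log D) +
      (t * (a i - Real.log A) + u * (b i - Real.log D)) := by ring
    rw [e, Real.exp_add]
    gcongr
  refine (Finset.sum_le_sum key).trans (le_of_eq ?_)
  rw [← Finset.mul_sum, Finset.sum_add_distrib, ← Finset.mul_sum, ← Finset.mul_sum,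
    ← Finset.sum_div, ← Finset.sum_div, ← hA, ← hD, div_self hA0.ne', div_self hD0.ne']
  rw [mul_one, mul_one, htu, mul_one]

theorem birkhoffSum_add_mul (ζ η : Seq → ℝ) (h : ℝ) (n : ℕ) (x : Seq) :
    birkhoffSum shift (fun y => ζ y + h * η y) n x =
      birkhoffSum shift ζ n x + h * birkhoffSum shift η n x := by
  simp [birkhoffSum, Finset.sum_add_distrib, Finset.mul_sum]

theorem birkhoffSum_mul (φ : Seq → ℝ) (q : ℝ) (n : ℕ) (x : Seq) :
    birkhoffSum shift (fun y => q * φ y) n x = q * birkhoffSum shift φ n x := by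
  simp [birkhoffSum, Finset.mul_sum]

section

variable {m R : ℕ} {X : Set Seq} {C θ : ℝ}

theorem IsTransitiveMarkov.pressure_add_const (hX : IsTransitiveMarkov m R X) {g : Seq → ℝ}
    (hg : Regular g C θ) (hθ0 : 0 ≤ θ) (hθ1 : θ < 1) (a : ℝ) :
    pressure X (fun x => g x + a) = pressure X g + a := by
  obtain ⟨x, hx⟩ := hX.nonempty
  obtain ⟨c, hc, h⟩ := hX.exists_pressure_bounds (C + |a|) hθ0 hθ1
  have h1 := (h g (hg.mono (by linarith [abs_nonneg a]) hθ0)).2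
  have h2 := (h (fun x => g x + a) (hg.add (regular_const a θ hθ0))).2
  have hc0 : 0 < c := by linarith
  have e : ∀ n : ℕ, op X (fun x => g x + a) n 1 x = Real.exp (n * a) * op X g n 1 x := by
    intro n
    unfold op
    rw [Finset.mul_sum]
    refine Finset.sum_congr rfl fun y _ => ?_
    have : birkhoffSum shift (fun x => g x + a) n y = n * a + birkhoffSum shift g n y := by
      simp [birkhoffSum, Finset.sum_add_distrib, add_comm]
    rw [this, Real.exp_add, mul_assoc]
  apply le_antisymm
  · refine le_of_exp_nat_mul_le (K := c * c) fun n => ?_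
    have h3 := (h2 n x hx).1
    rw [e, inv_mul_le_iff₀ hc0] at h3
    have h4 := (h1 n x hx).2
    calc _ ≤ c * (Real.exp (n * a) * op X g n 1 x) := h3
      _ ≤ c * (Real.exp (n * a) * (c * Real.exp (n * pressure X g))) := by gcongr
      _ = _ := by rw [mul_add, Real.exp_add]; ring
  · refine le_of_exp_nat_mul_le (K := c * c) fun n => ?_
    have h3 := (h2 n x hx).2
    rw [e] at h3
    have h4 := (h1 n x hx).1
    rw [inv_mul_le_iff₀ hc0] at h4
    calc _ = Real.exp (n * a) * Real.exp (n * pressure X g) := by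
          rw [mul_add, Real.exp_add, mul_comm]
      _ ≤ Real.exp (n * a) * (c * op X g n 1 x) := by gcongr
      _ = c * (Real.exp (n * a) * op X g n 1 x) := by ring
      _ ≤ _ := by rw [mul_assoc]; gcongr

/-- Log-convexity of the sum over the preimages of a single point passes to the growth rate. -/
theorem IsTransitiveMarkov.convexOn_pressure (hX : IsTransitiveMarkov m R X) {φ : Seq → ℝ}
    (hφ : Regular φ C θ) (hθ0 : 0 ≤ θ) (hθ1 : θ < 1) :
    ConvexOn ℝ univ (fun q : ℝ => pressure X (fun x => q * φ x)) := by
  refine ⟨convex_univ, fun p _ q _ t u ht hu htu => ?_⟩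
  obtain ⟨x, hx⟩ := hX.nonempty
  obtain ⟨c, hc, h⟩ := hX.exists_pressure_bounds ((|p| + |q|) * C) hθ0 hθ1
  have hc0 : 0 < c := by linarith
  have hC := hφ.nonneg
  have hreg : ∀ r : ℝ, |r| ≤ |p| + |q| → Regular (fun x => r * φ x) ((|p| + |q|) * C) θ :=
    fun r hr => (hφ.const_mul r).mono (by gcongr) hθ0
  have hp := (h _ (hreg p (by linarith [abs_nonneg q]))).2
  have hq := (h _ (hreg q (by linarith [abs_nonneg p]))).2
  have hpq := (h _ (hreg (t * p + u * q) (by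
    refine (abs_add_le _ _).trans ?_
    rw [abs_mul, abs_mul, abs_of_nonneg ht, abs_of_nonneg hu]
    have := abs_nonneg p
    have := abs_nonneg q
    gcongr <;> nlinarith))).2
  simp only [smul_eq_mul]
  refine le_of_exp_nat_mul_le (K := c * c) fun n => ?_
  have hpos : ∀ r : ℝ, |r| ≤ |p| + |q| → 0 < op X (fun x => r * φ x) n 1 x := fun r hr =>
    lt_of_lt_of_le (by positivity) ((h _ (hreg r hr)).2 n x hx).1
  have hne : (pre X n x).Nonempty := by
    by_contra hne
    rw [Finset.not_nonempty_iff_eq_empty] at hne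
    have := hpos p (by linarith [abs_nonneg q])
    simp [op, hne] at this
  have hop : ∀ r : ℝ, op X (fun x => r * φ x) n 1 x =
      ∑ y ∈ pre X n x, Real.exp (r * birkhoffSum shift φ n y) := by
    intro r
    simp [op, birkhoffSum_mul]
  have hlog : ∀ r : ℝ, |r| ≤ |p| + |q| → Real.log (op X (fun x => r * φ x) n 1 x) ≤
      Real.log c + n * pressure X (fun x => r * φ x) := by
    intro r hr
    rw [← Real.log_exp (n * pressure X fun x => r * φ x), ← Real.log_mul hc0.ne'
      (Real.exp_pos _).ne']
    exact Real.log_le_log (hpos r hr) ((h _ (hreg r hr)).2 n x hx).2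
  have h1 := (hpq n x hx).1
  rw [inv_mul_le_iff₀ hc0] at h1
  have h2 := log_sum_exp_convex hne (fun y => p * birkhoffSum shift φ n y)
    (fun y => q * birkhoffSum shift φ n y) ht hu htu
  simp only [← hop] at h2
  have h3 : op X (fun x => (t * p + u * q) * φ x) n 1 x ≤ Real.exp
      (t * Real.log (op X (fun x => p * φ x) n 1 x) +
        u * Real.log (op X (fun x => q * φ x) n 1 x)) := by
    refine le_trans (le_of_eq ?_) h2
    rw [hop]
    exact Finset.sum_congr rfl fun y _ => by congr 1; ring
  have h4 := hlog p (by linarith [abs_nonneg q])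
  have h5 := hlog q (by linarith [abs_nonneg p])
  calc _ ≤ c * op X (fun x => (t * p + u * q) * φ x) n 1 x := h1
    _ ≤ c * Real.exp (t * (Real.log c + n * pressure X (fun x => p * φ x)) +
        u * (Real.log c + n * pressure X (fun x => q * φ x))) := by
        gcongr
        exact h3.trans (Real.exp_le_exp.2 (by gcongr))
    _ = c * (Real.exp (Real.log c) * Real.exp (n * (t * pressure X (fun x => p * φ x) +
        u * pressure X (fun x => q * φ x)))) := by
        rw [← Real.exp_add]; congr 2
        have hu1 : u = 1 - t := by linarith
        subst hu1; ring
    _ = _ := by rw [Real.exp_log hc0]; ring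

/-! ### Block operators and the exclusion of kinks -/

/-- The transfer operator of a block of length between `n` and `n + R`. -/
noncomputable def blockOp (X : Set Seq) (g : Seq → ℝ) (R n : ℕ) (f : Seq → ℝ) (x : Seq) : ℝ :=
  op X g n (sumOp X g R f) x

theorem blockOp_eq_sum (hX : ∀ x ∈ X, shift x ∈ X) (g : Seq → ℝ) (R n : ℕ) (f : Seq → ℝ)
    (x : Seq) : blockOp X g R n f x = ∑ r ∈ Finset.range (R + 1), op X g (r + n) f x := by
  unfold blockOp sumOp
  rw [op_sum]
  exact Finset.sum_congr rfl fun r _ => (op_add hX g r n f x).symm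

theorem blockOp_mono (g : Seq → ℝ) (R n : ℕ) {f f' : Seq → ℝ} (h : ∀ y ∈ X, f y ≤ f' y)
    (x : Seq) : blockOp X g R n f x ≤ blockOp X g R n f' x :=
  op_mono g n (fun y _ => sumOp_mono g R h y) x

theorem blockOp_const_mul (hX : ∀ x ∈ X, shift x ∈ X) (g : Seq → ℝ) (R n : ℕ) (f : Seq → ℝ)
    (c : ℝ) (x : Seq) : blockOp X g R n (fun y => c * f y) x = c * blockOp X g R n f x := by
  rw [blockOp_eq_sum hX, blockOp_eq_sum hX, Finset.mul_sum]
  exact Finset.sum_congr rfl fun r _ => op_const_mul _ _ _ _ _ _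

/-- Block operators of different potentials are comparable on the cone. -/
theorem IsTransitiveMarkov.exists_blockOp_le (hX : IsTransitiveMarkov m R X) (hC : 0 ≤ C)
    (hθ0 : 0 ≤ θ) (hθ1 : θ < 1) : ∃ K : ℝ, 1 ≤ K ∧ ∀ g g' : Seq → ℝ, Regular g C θ →
      Regular g' C θ → ∀ f : Seq → ℝ, InCone X m θ (C / (1 - θ)) f → ∀ n : ℕ, ∀ x ∈ X,
      blockOp X g R n f x ≤
        K * Real.exp (n * (pressure X g - pressure X g')) * blockOp X g' R n f x := by
  obtain ⟨x₀, hx₀⟩ := hX.nonempty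
  obtain ⟨c, hc, h⟩ := hX.exists_pressure_bounds C hθ0 hθ1
  have h1θ : 0 < 1 - θ := by linarith
  set B : ℝ := C / (1 - θ) with hBdef
  have hB0 : 0 ≤ B := by positivity
  set D : ℝ := sumBound C R * Real.exp (B + R * C) with hD
  have hD1 : 1 ≤ D := one_le_mul_of_one_le_of_one_le (one_le_sumBound _ _)
    (Real.one_le_exp (by positivity))
  have hD0 : 0 < D := by linarith
  have hc0 : 0 < c := by linarith
  refine ⟨(D * c) * (D * c), one_le_mul_of_one_le_of_one_le
    (one_le_mul_of_one_le_of_one_le hD1 hc) (one_le_mul_of_one_le_of_one_le hD1 hc), ?_⟩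
  intro g g' hg hg' f hf n x hx
  have hnn : ∀ g : Seq → ℝ, ∀ y, 0 ≤ sumOp X g R f y := fun g y =>
    Finset.sum_nonneg fun r _ => op_nonneg g r hf.nonneg y
  -- Up to the factor `D`, `sumOp X g R f` is constant on `X`, with the same constant for every
  -- potential of the class. What remains is `op X g n 1`, whose growth is known.
  have cmp : ∀ g g' : Seq → ℝ, Regular g C θ → Regular g' C θ → ∀ y, ∀ y' ∈ X,
      sumOp X g R f y ≤ D * sumOp X g' R f y' := by
    intro g g' hg hg' y y' hy'
    rw [hD, mul_assoc]
    refine sumOp_le hg R (mul_nonneg (Real.exp_pos _).le (hnn g' y')) (fun z hz => ?_) y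
    exact hX.le_sumOp hg' hθ0 hθ1.le hB0 hf hz hy'
  set N := sumOp X g R f x₀ with hN
  have hN0 : 0 ≤ N := hnn g x₀
  have up : blockOp X g R n f x ≤ (D * c) * Real.exp (n * pressure X g) * N := by
    calc blockOp X g R n f x ≤ op X g n (fun y => (D * N) * (1 : Seq → ℝ) y) x :=
          op_mono g n (fun y _ => by simpa using cmp g g hg hg y x₀ hx₀) x
      _ = D * N * op X g n 1 x := op_const_mul _ _ _ _ _ _
      _ ≤ D * N * (c * Real.exp (n * pressure X g)) := by
          gcongr; exact ((h g hg).2 n x hx).2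
      _ = _ := by ring
  have low : Real.exp (n * pressure X g') * N ≤ (D * c) * blockOp X g' R n f x := by
    have h1 := ((h g' hg').2 n x hx).1
    rw [inv_mul_le_iff₀ hc0] at h1
    have h2 : N * op X g' n 1 x ≤ D * blockOp X g' R n f x := by
      have := op_mono (X := X) (f := fun y => N * (1 : Seq → ℝ) y)
        (f' := fun y => D * sumOp X g' R f y) g' n
        (fun y hy => by simpa using cmp g g' hg hg' x₀ y hy) x
      rwa [op_const_mul, op_const_mul] at this
    calc _ ≤ c * op X g' n 1 x * N := by gcongr
      _ = c * (N * op X g' n 1 x) := by ring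
      _ ≤ c * (D * blockOp X g' R n f x) := by gcongr
      _ = _ := by ring
  calc _ ≤ (D * c) * Real.exp (n * pressure X g) * N := up
    _ = (D * c) * Real.exp (n * (pressure X g - pressure X g')) *
        (Real.exp (n * pressure X g') * N) := by
        rw [mul_sub, Real.exp_sub]; field_simp
    _ ≤ (D * c) * Real.exp (n * (pressure X g - pressure X g')) *
        ((D * c) * blockOp X g' R n f x) := by gcongr
    _ = _ := by ring

/-- Expanding `k` block operators gives `(R + 1) ^ k` iterates of `op`, each at least `a` whatever
its length. The additional `l` steps make the induction close. -/
theorem le_op_iterate_blockOp (hX : ∀ x ∈ X, shift x ∈ X) {g : Seq → ℝ} {a : ℝ}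
    (h : ∀ l : ℕ, ∀ x ∈ X, a ≤ op X g l 1 x) (n k l : ℕ) {x : Seq} (hx : x ∈ X) :
    a * (R + 1) ^ k ≤ op X g l ((blockOp X g R n)^[k] 1) x := by
  induction k generalizing l with
  | zero => simpa using h l x hx
  | succ k ih =>
    rw [Function.iterate_succ_apply']
    have e : blockOp X g R n ((blockOp X g R n)^[k] 1) =
      fun y => ∑ r ∈ Finset.range (R + 1), op X g (r + n) ((blockOp X g R n)^[k] 1) y :=
      funext fun y => blockOp_eq_sum hX _ _ _ _ _
    rw [e, op_sum]
    calc _ = ∑ r ∈ Finset.range (R + 1), a * ((R : ℝ) + 1) ^ k := by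
          simp; ring
      _ ≤ _ := Finset.sum_le_sum fun r _ => by rw [← op_add hX]; exact ih _

theorem op_iterate_blockOp_le (hX : ∀ x ∈ X, shift x ∈ X) {g : Seq → ℝ} {a : ℝ}
    (h : ∀ l : ℕ, ∀ x ∈ X, op X g l 1 x ≤ a) (n k l : ℕ) {x : Seq} (hx : x ∈ X) :
    op X g l ((blockOp X g R n)^[k] 1) x ≤ a * (R + 1) ^ k := by
  induction k generalizing l with
  | zero => simpa using h l x hx
  | succ k ih =>
    rw [Function.iterate_succ_apply']
    have e : blockOp X g R n ((blockOp X g R n)^[k] 1) =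
      fun y => ∑ r ∈ Finset.range (R + 1), op X g (r + n) ((blockOp X g R n)^[k] 1) y :=
      funext fun y => blockOp_eq_sum hX _ _ _ _ _
    rw [e, op_sum]
    calc _ ≤ ∑ r ∈ Finset.range (R + 1), a * ((R : ℝ) + 1) ^ k :=
          Finset.sum_le_sum fun r _ => by rw [← op_add hX]; exact ih _
      _ = _ := by simp; ring

/-- A pointwise inequality between exponentials of Birkhoff sums passes to block operators. -/
theorem blockOp_le_of_exp_le (hX : ∀ x ∈ X, shift x ∈ X) {ζ η : Seq → ℝ} (hη : Regular η C θ)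
    {f : Seq → ℝ} (hf : ∀ y ∈ X, 0 ≤ f y) {n : ℕ} {a₀ a₁ a₂ h h₁ h₂ : ℝ}
    (hexp : ∀ s : ℝ, |s| ≤ (n + R) * C →
      Real.exp (h * s) ≤ a₀ + a₁ * Real.exp (h₁ * s) + a₂ * Real.exp (h₂ * s)) (x : Seq) :
    blockOp X (fun y => ζ y + h * η y) R n f x ≤ a₀ * blockOp X (fun y => ζ y + 0 * η y) R n f x +
      a₁ * blockOp X (fun y => ζ y + h₁ * η y) R n f x +
      a₂ * blockOp X (fun y => ζ y + h₂ * η y) R n f x := by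
  simp only [blockOp_eq_sum hX]
  rw [Finset.mul_sum, Finset.mul_sum, Finset.mul_sum, ← Finset.sum_add_distrib,
    ← Finset.sum_add_distrib]
  refine Finset.sum_le_sum fun r hr => ?_
  unfold op
  rw [Finset.mul_sum, Finset.mul_sum, Finset.mul_sum, ← Finset.sum_add_distrib,
    ← Finset.sum_add_distrib]
  refine Finset.sum_le_sum fun y hy => ?_
  rw [birkhoffSum_add_mul, birkhoffSum_add_mul, birkhoffSum_add_mul, birkhoffSum_add_mul, zero_mul,
    add_zero, Real.exp_add, Real.exp_add, Real.exp_add]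
  have hs : |birkhoffSum shift η (r + n) y| ≤ (n + R) * C := by
    refine (hη.abs_birkhoffSum_le _ _).trans ?_
    have := hη.nonneg
    have hr' : (r : ℝ) ≤ R := by exact_mod_cast Nat.lt_succ_iff.1 (Finset.mem_range.1 hr)
    push_cast
    nlinarith
  have h1 := mul_le_mul_of_nonneg_left (hexp _ hs)
    (mul_nonneg (Real.exp_nonneg (birkhoffSum shift ζ (r + n) y)) (hf y (mem_pre.1 hy).1))
  linarith

/-- The exponential function is bounded by a combination which is small on average. -/
theorem exp_le_combination {b t γ ε u X : ℝ} (ht : 0 ≤ t) (hγ : 0 ≤ γ) (hε : 0 ≤ ε) (hu : 1 ≤ u)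
    (hX : -b ≤ X) :
    Real.exp X ≤ Real.exp ε - (1 - Real.exp (-(γ / 2))) * Real.exp (-(b * t)) *
      (Real.exp (-(t * X)) - Real.exp (t * γ / 2)) + Real.exp (ε - u * ε) * Real.exp (u * X) := by
  have hκ : 0 ≤ 1 - Real.exp (-(γ / 2)) := by
    have : Real.exp (-(γ / 2)) ≤ 1 := Real.exp_le_one_iff.2 (by linarith)
    linarith
  have hlast : 0 ≤ Real.exp (ε - u * ε) * Real.exp (u * X) := by positivity
  have hκb : 0 ≤ (1 - Real.exp (-(γ / 2))) * Real.exp (-(b * t)) := by positivity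
  -- For `X ≤ -γ / 2` the subtracted term is at most `1 - exp (-γ / 2)`, leaving room for `exp X`;
  -- up to `ε` the first term suffices, and beyond `ε` the last one does.
  by_cases h1 : -(γ / 2) < X
  · have h2 : Real.exp (-(t * X)) ≤ Real.exp (t * γ / 2) := Real.exp_le_exp.2 (by nlinarith)
    have h3 : (1 - Real.exp (-(γ / 2))) * Real.exp (-(b * t)) *
      (Real.exp (-(t * X)) - Real.exp (t * γ / 2)) ≤ 0 :=
      mul_nonpos_of_nonneg_of_nonpos hκb (by linarith)
    by_cases h4 : X ≤ ε
    · have := Real.exp_le_exp.2 h4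
      linarith
    · push Not at h4
      have h5 : Real.exp X ≤ Real.exp (ε - u * ε) * Real.exp (u * X) := by
        rw [← Real.exp_add]; exact Real.exp_le_exp.2 (by nlinarith)
      have := Real.exp_pos ε
      linarith
  · push Not at h1
    have h2 : Real.exp (-(b * t)) * (Real.exp (-(t * X)) - Real.exp (t * γ / 2)) ≤ 1 := by
      have h3 : Real.exp (-(b * t)) * Real.exp (-(t * X)) ≤ 1 := by
        rw [← Real.exp_add]; exact Real.exp_le_one_iff.2 (by nlinarith)
      have : 0 ≤ Real.exp (-(b * t)) * Real.exp (t * γ / 2) := by positivity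
      linarith
    have h3 : Real.exp X ≤ Real.exp (-(γ / 2)) := Real.exp_le_exp.2 h1
    have h4 := mul_le_mul_of_nonneg_left h2 hκ
    have h5 := Real.one_le_exp hε
    linarith

/-- If the pressure of `ζ + h * η` has a kink at `h = 0`, the block operators of `ζ + h * η` are
contracted by those of `ζ` for some `h`. -/
theorem IsTransitiveMarkov.exists_blockOp_contraction (hX : IsTransitiveMarkov m R X)
    {ζ η : Seq → ℝ} {C' : ℝ} (hζ : Regular ζ C' θ) (hη : Regular η C θ) (hθ0 : 0 ≤ θ)
    (hθ1 : θ < 1) {γ : ℝ} (hγ : 0 < γ) {p : ℝ → ℝ}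
    (hp : ∀ h, p h = pressure X (fun y => ζ y + h * η y)) (hp0 : p 0 = 0)
    (hneg : ∀ t, 0 ≤ t → γ * t ≤ p (-t))
    (hsmall : ∀ ε > 0, ∃ h > 0, h ≤ 1 ∧ p h ≤ ε * h) :
    ∃ (n : ℕ) (d : ℝ), 0 < n ∧ 0 < d ∧ ∀ f, InCone X m θ ((C' + C) / (1 - θ)) f → ∀ x ∈ X,
      blockOp X (fun y => ζ y + (1 / n) * η y) R n f x ≤
        (1 - d) * blockOp X (fun y => ζ y + 0 * η y) R n f x := by
  have hC' := hζ.nonneg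
  have hC := hη.nonneg
  have hreg : ∀ h : ℝ, |h| ≤ 1 → Regular (fun y => ζ y + h * η y) (C' + C) θ := fun h hh =>
    hζ.add ((hη.const_mul h).mono (by nlinarith) hθ0)
  have hC1 : 0 ≤ C' + C := by linarith
  obtain ⟨K, hK, hblock⟩ := hX.exists_blockOp_le hC1 hθ0 hθ1
  have hK0 : 0 < K := by linarith
  -- Tilting by `-(t / n)` gains `exp (γ * t) = (2 * K) ^ 2` over a block. Despite the loss of `K`
  -- in `exists_blockOp_le`, this gives `T₂ ≥ 4 * K * T₀`, twice the `2 * K` that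
  -- `exp_le_combination` offsets.
  obtain ⟨t, ht0, htK⟩ : ∃ t : ℝ, 0 ≤ t ∧ Real.exp (t * γ / 2) = 2 * K := by
    refine ⟨2 * Real.log (2 * K) / γ, ?_, ?_⟩
    · have := Real.log_nonneg (by linarith : 1 ≤ 2 * K)
      positivity
    · have : 2 * Real.log (2 * K) / γ * γ / 2 = Real.log (2 * K) := by field_simp
      rw [this, Real.exp_log (by linarith)]
  obtain ⟨κ, hκ⟩ : ∃ κ : ℝ, κ = (1 - Real.exp (-(γ / 2))) * Real.exp (-(2 * C * t)) := ⟨_, rfl⟩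
  have hκ0 : 0 < κ := by
    have : Real.exp (-(γ / 2)) < 1 := Real.exp_lt_one_iff.2 (by linarith)
    rw [hκ]
    exact mul_pos (by linarith) (Real.exp_pos _)
  -- The net gain from `T₂` is `2 * d - d = d`; the terms with `exp ε` and `T₃` cost `d / 4` each,
  -- so a contraction by `1 - d / 2` remains.
  obtain ⟨d, hd⟩ : ∃ d : ℝ, d = κ * (2 * K) := ⟨_, rfl⟩
  have hd0 : 0 < d := by rw [hd]; positivity
  obtain ⟨ε, hε0, hexpε⟩ : ∃ ε : ℝ, 0 < ε ∧ Real.exp ε = 1 + d / 4 :=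
    ⟨Real.log (1 + d / 4), Real.log_pos (by linarith), Real.exp_log (by linarith)⟩
  -- Since `p h' ≤ ε * h' / 2`, the growth of `T₃` over a block is beaten by the factor `exp (ε - h'
  -- * n * ε)`.
  obtain ⟨h', hh'0, hh'1, hph'⟩ := hsmall (ε / 2) (by linarith)
  -- `R + 1 ≤ n` bounds the sums of `η` over a block by `2 * C * n`, `t ≤ n` keeps the tilted
  -- potential in the class where `K` applies, and `1 ≤ h' * n` is the condition `1 ≤ u` of
  -- `exp_le_combination`.
  obtain ⟨n, hnR, hnt, hnh, hnK⟩ : ∃ n : ℕ, R + 1 ≤ n ∧ t ≤ n ∧ 1 ≤ h' * n ∧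
      K * Real.exp ε * Real.exp (-(n * (ε * h' / 2))) ≤ d / 4 := by
    have hlim : Tendsto (fun n : ℕ => K * Real.exp ε * Real.exp (-(n * (ε * h' / 2)))) atTop
        (𝓝 (K * Real.exp ε * 0)) := by
      refine Tendsto.const_mul _ (Real.tendsto_exp_neg_atTop_nhds_zero.comp ?_)
      exact tendsto_natCast_atTop_atTop.atTop_mul_const (by positivity)
    rw [mul_zero] at hlim
    have e1 := hlim.eventually (ge_mem_nhds (by positivity : (0 : ℝ) < d / 4))
    have e2 : ∀ᶠ n : ℕ in atTop, t ≤ n := tendsto_natCast_atTop_atTop.eventually_ge_atTop t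
    have e3 : ∀ᶠ n : ℕ in atTop, 1 / h' ≤ (n : ℝ) :=
      tendsto_natCast_atTop_atTop.eventually_ge_atTop _
    obtain ⟨n, h1, h2, h3, h4⟩ := (e1.and (e2.and (e3.and (eventually_ge_atTop (R + 1))))).exists
    refine ⟨n, h4, h2, ?_, h1⟩
    rw [div_le_iff₀ hh'0] at h3
    linarith
  have hn0 : (0 : ℝ) < n := by exact_mod_cast (by omega : 0 < n)
  have hnR' : (R : ℝ) + 1 ≤ n := by exact_mod_cast hnR
  have hnt' : |-(t / n)| ≤ 1 := by
    rw [abs_neg, abs_of_nonneg (by positivity), div_le_one hn0]; exact hnt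
  have hh'a : |h'| ≤ 1 := by rwa [abs_of_pos hh'0]
  refine ⟨n, d / 2, by omega, by linarith, fun f hf x hx => ?_⟩
  have hTnn : ∀ h : ℝ, 0 ≤ blockOp X (fun y => ζ y + h * η y) R n f x := fun h =>
    op_nonneg _ _ (fun y _ => Finset.sum_nonneg fun r _ => op_nonneg _ r hf.nonneg y) x
  have hexp : ∀ s : ℝ, |s| ≤ (n + R) * C → Real.exp (1 / n * s) ≤
      (Real.exp ε + κ * Real.exp (t * γ / 2)) + (-κ) * Real.exp (-(t / n) * s) +
        Real.exp (ε - h' * n * ε) * Real.exp (h' * s) := by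
    intro s hs
    have hsb : -(2 * C) ≤ s / n := by
      rw [le_div_iff₀ hn0]
      have h2 := (abs_le.1 hs).1
      have h3 : ((n : ℝ) + R) * C ≤ (n + n) * C := by gcongr; linarith
      linarith
    have h4 := exp_le_combination ht0 hγ.le hε0.le hnh hsb
    have e1 : 1 / (n : ℝ) * s = s / n := by ring
    have e2 : -(t / n) * s = -(t * (s / n)) := by ring
    have e3 : h' * s = h' * n * (s / n) := by field_simp
    rw [e1, e2, e3]
    rw [← hκ] at h4
    linarith
  have h1 := blockOp_le_of_exp_le (R := R) hX.shift_mem (ζ := ζ) hη hf.nonneg hexp x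
  have h3 := hblock _ _ (hreg 0 (by simp)) (hreg _ hnt') f hf n x hx
  have h4 := hblock _ _ (hreg h' hh'a) (hreg 0 (by simp)) f hf n x hx
  rw [← hp, ← hp, hp0] at h3 h4
  have hT0 := hTnn 0
  have hT2 := hTnn (-(t / n))
  have hT3 := hTnn h'
  generalize blockOp X (fun y => ζ y + 0 * η y) R n f x = T₀ at *
  generalize blockOp X (fun y => ζ y + (1 / n) * η y) R n f x = T₁ at *
  generalize blockOp X (fun y => ζ y + -(t / n) * η y) R n f x = T₂ at *
  generalize blockOp X (fun y => ζ y + h' * η y) R n f x = T₃ at *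
  have h5 : 2 * (2 * K) * T₀ ≤ T₂ := by
    have h6 : Real.exp (n * (0 - p (-(t / n)))) ≤ (1 / (2 * K)) * (1 / (2 * K)) := by
      have h5 := hneg (t / n) (by positivity)
      have h6 : γ * t ≤ n * p (-(t / n)) := by
        have := mul_le_mul_of_nonneg_left h5 hn0.le
        have e : (n : ℝ) * (γ * (t / n)) = γ * t := by field_simp
        linarith
      calc Real.exp (n * (0 - p (-(t / n)))) ≤ Real.exp (-(t * γ / 2) + -(t * γ / 2)) :=
            Real.exp_le_exp.2 (by linarith)
        _ = _ := by rw [Real.exp_add, Real.exp_neg, htK, one_div]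
    have h7 : T₀ ≤ K * ((1 / (2 * K)) * (1 / (2 * K))) * T₂ := h3.trans (by gcongr)
    have e : K * ((1 / (2 * K)) * (1 / (2 * K))) = 1 / (4 * K) := by field_simp; norm_num
    rw [e, one_div, ← div_eq_inv_mul, le_div_iff₀ (by positivity)] at h7
    linarith
  have h6 : Real.exp (ε - h' * n * ε) * T₃ ≤ d / 4 * T₀ := by
    have h5 : Real.exp (n * (p h' - 0)) ≤ Real.exp (n * (ε / 2 * h')) := by
      apply Real.exp_le_exp.2
      gcongr
      linarith
    calc Real.exp (ε - h' * n * ε) * T₃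
        ≤ Real.exp (ε - h' * n * ε) * (K * Real.exp (n * (ε / 2 * h')) * T₀) := by
          gcongr
          exact h4.trans (by gcongr)
      _ = K * Real.exp ε * Real.exp (-(n * (ε * h' / 2))) * T₀ := by
          have : Real.exp (ε - h' * n * ε) * Real.exp (n * (ε / 2 * h')) =
            Real.exp ε * Real.exp (-(n * (ε * h' / 2))) := by
            rw [← Real.exp_add, ← Real.exp_add]; congr 1; ring
          linear_combination (K * T₀) * this
      _ ≤ _ := by gcongr
  have h7 : κ * (2 * (2 * K) * T₀) ≤ κ * T₂ := by gcongr
  have e : κ * (2 * (2 * K) * T₀) = 2 * (d * T₀) := by rw [hd]; ring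
  rw [htK, hexpε, ← hd] at h1
  linarith

/-- The pressure of `ζ + h * η`, if zero at `h = 0`, cannot have right derivative zero and
negative left derivative there. -/
theorem IsTransitiveMarkov.false_of_kink (hX : IsTransitiveMarkov m R X) {ζ η : Seq → ℝ} {C' : ℝ}
    (hζ : Regular ζ C' θ) (hη : Regular η C θ) (hθ0 : 0 ≤ θ) (hθ1 : θ < 1) {γ : ℝ} (hγ : 0 < γ)
    {p : ℝ → ℝ} (hp : ∀ h, p h = pressure X (fun y => ζ y + h * η y)) (hp0 : p 0 = 0)
    (hpos : ∀ h, 0 ≤ h → 0 ≤ p h) (hneg : ∀ t, 0 ≤ t → γ * t ≤ p (-t))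
    (hsmall : ∀ ε > 0, ∃ h > 0, h ≤ 1 ∧ p h ≤ ε * h) : False := by
  have hC' := hζ.nonneg
  have hC := hη.nonneg
  have hreg : ∀ h : ℝ, |h| ≤ 1 → Regular (fun y => ζ y + h * η y) (C' + C) θ := fun h hh =>
    hζ.add ((hη.const_mul h).mono (by nlinarith) hθ0)
  have hC1 : 0 ≤ C' + C := by linarith
  obtain ⟨x₀, hx₀⟩ := hX.nonempty
  obtain ⟨c, hc, hbd⟩ := hX.exists_pressure_bounds (C' + C) hθ0 hθ1
  obtain ⟨n, d, hn, hd, contr⟩ :=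
    hX.exists_blockOp_contraction hζ hη hθ0 hθ1 hγ hp hp0 hneg hsmall
  have hc0 : 0 < c := by linarith
  have h1θ : 0 < 1 - θ := by linarith
  have hn0 : (0 : ℝ) < n := by exact_mod_cast hn
  have hn1 : |1 / (n : ℝ)| ≤ 1 := by
    rw [abs_of_pos (by positivity), div_le_one hn0]
    exact_mod_cast hn
  have hB0 : 0 ≤ (C' + C) / (1 - θ) := by positivity
  have hB : C' + C ≤ (C' + C) / (1 - θ) * (1 - θ) := by rw [div_mul_cancel₀ _ h1θ.ne']
  generalize (C' + C) / (1 - θ) = B at *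
  have hg₁ := hreg _ hn1
  have hg₀ := hreg 0 (by simp)
  have hlow₁ : ∀ l : ℕ, ∀ x ∈ X, c⁻¹ ≤ op X (fun y => ζ y + (1 / n) * η y) l 1 x := by
    intro l x hx
    have h1 := ((hbd _ hg₁).2 l x hx).1
    refine le_trans (le_mul_of_one_le_right (by positivity) (Real.one_le_exp ?_)) h1
    rw [← hp]
    exact mul_nonneg (by positivity) (hpos _ (by positivity))
  have hup₀ : ∀ l : ℕ, ∀ x ∈ X, op X (fun y => ζ y + 0 * η y) l 1 x ≤ c := by
    intro l x hx
    have h1 := ((hbd _ hg₀).2 l x hx).2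
    rw [← hp, hp0] at h1
    simpa using h1
  generalize (fun y => ζ y + (1 / n) * η y) = g₁ at *
  generalize (fun y => ζ y + 0 * η y) = g₀ at *
  have hlow : ∀ k, c⁻¹ * ((R : ℝ) + 1) ^ k ≤ (blockOp X g₁ R n)^[k] 1 x₀ := by
    intro k
    have := le_op_iterate_blockOp (R := R) hX.shift_mem hlow₁ n k 0 hx₀
    rwa [op_zero_apply _ _ hx₀] at this
  have hhigh : ∀ k, (blockOp X g₀ R n)^[k] 1 x₀ ≤ c * ((R : ℝ) + 1) ^ k := by
    intro k
    have := op_iterate_blockOp_le (R := R) hX.shift_mem hup₀ n k 0 hx₀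
    rwa [op_zero_apply _ _ hx₀] at this
  -- Nonnegativity of the contraction factor is needed to iterate the inequality.
  have hd2 : 0 ≤ 1 - d := by
    have h2 := contr 1 (inCone_one hθ0 hB0) x₀ hx₀
    have h3 : 0 < blockOp X g₁ R n 1 x₀ := lt_of_lt_of_le (by positivity) (hlow 1)
    have h4 : 0 ≤ blockOp X g₀ R n 1 x₀ := op_nonneg _ _ (fun y _ =>
      Finset.sum_nonneg fun r _ => op_nonneg _ r (fun _ _ => zero_le_one) y) x₀
    by_contra! h5
    have := mul_nonpos_of_nonpos_of_nonneg h5.le h4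
    linarith
  have hiter : ∀ k, InCone X m θ B ((blockOp X g₁ R n)^[k] 1) := by
    intro k
    induction k with
    | zero => exact inCone_one hθ0 hB0
    | succ k ih =>
      rw [Function.iterate_succ_apply']
      exact hX.inCone_op hg₁ hθ0 hθ1.le hB (hX.inCone_sumOp hg₁ hθ0 hθ1.le hB ih R) n
  have hle : ∀ k, ∀ x ∈ X, (blockOp X g₁ R n)^[k] 1 x ≤
      (1 - d) ^ k * (blockOp X g₀ R n)^[k] 1 x := by
    intro k
    induction k with
    | zero => intro x _; simp
    | succ k ih =>
      intro x hx
      rw [Function.iterate_succ_apply', Function.iterate_succ_apply']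
      calc _ ≤ (1 - d) * blockOp X g₀ R n ((blockOp X g₁ R n)^[k] 1) x := contr _ (hiter k) x hx
        _ ≤ (1 - d) * blockOp X g₀ R n (fun y => (1 - d) ^ k * (blockOp X g₀ R n)^[k] 1 y) x := by
            gcongr
            exact blockOp_mono _ _ _ ih x
        _ = _ := by rw [blockOp_const_mul hX.shift_mem]; ring
  -- The number `(R + 1) ^ k` of terms cancels between the lower bound, from `p (1 / n) ≥ 0`, and
  -- the upper bound, from `p 0 = 0`.
  have hall : ∀ k : ℕ, c⁻¹ ≤ (1 - d) ^ k * c := by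
    intro k
    have h1 := (hlow k).trans ((hle k x₀ hx₀).trans
      (mul_le_mul_of_nonneg_left (hhigh k) (by positivity)))
    rw [← mul_assoc] at h1
    exact le_of_mul_le_mul_right h1 (by positivity)
  have hlim : Tendsto (fun k : ℕ => (1 - d) ^ k * c) atTop (𝓝 (0 * c)) :=
    (tendsto_pow_atTop_nhds_zero_of_lt_one hd2 (by linarith)).mul_const c
  have := ge_of_tendsto' hlim hall
  rw [zero_mul] at this
  exact absurd this (not_le.2 (by positivity))

/-- A convex function has one-sided derivatives, so only `β < α` must be refuted. Adding constants
to potentials shifts pressures, so subtracting the line of slope `α` reduces a kink to the normal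
form of `false_of_kink`. -/
theorem IsTransitiveMarkov.differentiable_pressure (hX : IsTransitiveMarkov m R X) {φ : Seq → ℝ}
    (hφ : Regular φ C θ) (hθ0 : 0 ≤ θ) (hθ1 : θ < 1) :
    Differentiable ℝ (fun q : ℝ => pressure X (fun x => q * φ x)) := by
  intro q₀
  have hconv := hX.convexOn_pressure hφ hθ0 hθ1
  set P : ℝ → ℝ := fun q => pressure X (fun x => q * φ x) with hP
  have hint : q₀ ∈ interior (univ : Set ℝ) := by simp
  have hr := hconv.hasDerivWithinAt_rightDeriv_of_mem_interior hint
  have hl := hconv.hasDerivWithinAt_leftDeriv_of_mem_interior hint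
  have hlr := hconv.leftDeriv_le_rightDeriv_of_mem_interior hint
  set α := derivWithin P (Ioi q₀) q₀ with hα
  set β := derivWithin P (Iio q₀) q₀ with hβ
  rcases hlr.eq_or_lt with heq | hlt
  · rw [heq] at hl
    have h2 := hl.Iic_of_Iio.union hr.Ici_of_Ioi
    rw [Iic_union_Ici, hasDerivWithinAt_univ] at h2
    exact h2.differentiableAt
  exfalso
  have hζ : Regular (fun x => q₀ * φ x + (-P q₀)) (|q₀| * C + |-P q₀|) θ :=
    (hφ.const_mul q₀).add (regular_const _ θ hθ0)
  have hη : Regular (fun x => φ x + (-α)) (C + |-α|) θ := hφ.add (regular_const _ θ hθ0)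
  have hp : ∀ h : ℝ, P (q₀ + h) - P q₀ - h * α =
      pressure X (fun y => (q₀ * φ y + (-P q₀)) + h * (φ y + (-α))) := by
    intro h
    have e : (fun y => (q₀ * φ y + (-P q₀)) + h * (φ y + (-α))) =
        fun y => (q₀ + h) * φ y + (-P q₀ - h * α) := by funext y; ring
    rw [e, hX.pressure_add_const (hφ.const_mul (q₀ + h)) hθ0 hθ1]
    simp only [hP]; ring
  have hslope_r : ∀ h > 0, α * h ≤ P (q₀ + h) - P q₀ := by
    intro h hh
    have := hconv.rightDeriv_le_slope (mem_univ q₀) (mem_univ (q₀ + h)) (by linarith)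
      hr.differentiableWithinAt
    rw [slope_def_field, add_sub_cancel_left, le_div_iff₀ hh] at this
    exact this
  have hslope_l : ∀ h > 0, P q₀ - P (q₀ - h) ≤ β * h := by
    intro h hh
    have := hconv.slope_le_leftDeriv (mem_univ (q₀ - h)) (mem_univ q₀) (by linarith)
      hl.differentiableWithinAt
    rw [slope_def_field, sub_sub_cancel, div_le_iff₀ hh] at this
    exact this
  refine hX.false_of_kink hζ hη hθ0 hθ1 (γ := α - β) (by linarith)
    (p := fun h => P (q₀ + h) - P q₀ - h * α) hp (by simp) ?_ ?_ ?_
  · intro h hh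
    rcases hh.eq_or_lt with rfl | hh
    · simp
    · have := hslope_r h hh
      linarith
  · intro h hh
    rcases hh.eq_or_lt with rfl | hh
    · simp
    · have := hslope_l h hh
      rw [sub_eq_add_neg q₀] at this; linarith
  · intro ε hε
    have ht := hasDerivWithinAt_iff_tendsto_slope.1 hr
    have hnot : Ioi q₀ \ {q₀} = Ioi q₀ := by simp
    rw [hnot] at ht
    have h1 := ht.eventually (ge_mem_nhds (by linarith : α < α + ε))
    have h2 : ∀ᶠ y in 𝓝[>] q₀, y ∈ Ioc q₀ (q₀ + 1) := Ioc_mem_nhdsGT (by linarith)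
    obtain ⟨y, h3, h4⟩ := (h1.and h2).exists
    refine ⟨y - q₀, by linarith [h4.1], by linarith [h4.2], ?_⟩
    rw [slope_def_field, div_le_iff₀ (by linarith [h4.1])] at h3
    simp only [add_sub_cancel]
    linarith

end

end WaveletShift

namespace WaveletShift

/-! ### Transitive pieces of subshifts of finite type -/

theorem isTransitiveMarkov_univ : IsTransitiveMarkov 0 0 (univ : Set Seq) :=
  ⟨univ_nonempty, fun _ _ => mem_univ _, fun _ _ _ _ _ _ => mem_univ _,
    fun x _ _ _ => ⟨0, le_rfl, x, mem_univ _, fun _ hi => absurd hi (by omega), rfl⟩⟩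

/-- For the Markov property, paths joining any two states have uniformly bounded length. -/
theorem isTransitiveMarkov_of_exists_link {m : ℕ} {X : Set Seq} (hne : X.Nonempty)
    (hshift : ∀ x ∈ X, shift x ∈ X)
    (hsplice : ∀ (n : ℕ), ∀ y ∈ X, ∀ x ∈ X, Agree m (shift^[n] y) x → splice n y x ∈ X)
    (hlink : ∀ x ∈ X, ∀ y ∈ X, ∃ r, ∃ z ∈ X, Agree m z y ∧ shift^[r] z = x) :
    ∃ R, IsTransitiveMarkov m R X := by
  -- By splicing, a link length that works for one pair of points works for all pairs with the same
  -- prefixes of length `m`; there are finitely many pairs of prefixes.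
  have h : ∀ p : Word m × Word m, ∃ r, ∀ x ∈ X, ∀ y ∈ X, pref m x = p.1 → pref m y = p.2 →
      ∃ z ∈ X, Agree m z y ∧ shift^[r] z = x := by
    intro p
    by_cases hp : ∃ x ∈ X, ∃ y ∈ X, pref m x = p.1 ∧ pref m y = p.2
    · obtain ⟨x₀, hx₀, y₀, hy₀, hx₀p, hy₀p⟩ := hp
      obtain ⟨r, z, hz, hzy, hzx⟩ := hlink x₀ hx₀ y₀ hy₀
      refine ⟨r, fun x hx y hy hxp hyp => ?_⟩
      have hax : Agree m (shift^[r] z) x := by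
        rw [hzx]; exact agree_iff_pref_eq.2 (hx₀p.trans hxp.symm)
      refine ⟨splice r z x, hsplice r z hz x hx hax, ?_, shift_splice _ _ _⟩
      exact ((splice_agree_add hax).mono (by omega)).trans
        (hzy.trans (agree_iff_pref_eq.2 (hy₀p.trans hyp.symm)))
    · exact ⟨0, fun x hx y hy hxp hyp => absurd ⟨x, hx, y, hy, hxp, hyp⟩ hp⟩
  choose r hr using h
  refine ⟨Finset.univ.sup r, hne, hshift, hsplice, fun x hx y hy => ?_⟩
  exact ⟨r (pref m x, pref m y), Finset.le_sup (Finset.mem_univ _), hr _ x hx y hy rfl rfl⟩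

/-! ### Irreducible classes and their pieces -/

section Piece

variable {n : ℕ} {A : Set (Word n)}

theorem trans_pref_shift {t : Seq} (ht : t ∈ sft A) (i : ℕ) :
    Trans A (pref (n - 1) (shift^[i] t)) (pref (n - 1) (shift^[i + 1] t)) := by
  refine ⟨_, ht i, fun j => rfl, fun j => ?_⟩
  simp only [pref, iterate_shift_apply]
  congr 1
  omega

theorem transGen_pref_shift {t : Seq} (ht : t ∈ sft A) {i j : ℕ} (hij : i < j) :
    Relation.TransGen (Trans A) (pref (n - 1) (shift^[i] t)) (pref (n - 1) (shift^[j] t)) := by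
  induction j, hij using Nat.le_induction with
  | base => exact .single (trans_pref_shift ht i)
  | succ j _ ih => exact ih.tail (trans_pref_shift ht j)

/-- Agreement on `n - 1` letters past the cut makes each window starting before `k` a window of `y`.
-/
theorem mem_sft_splice {y x : Seq} (hy : y ∈ sft A) (hx : x ∈ sft A) {k : ℕ}
    (h : Agree (n - 1) (shift^[k] y) x) : splice k y x ∈ sft A := by
  intro j
  by_cases hj : j < k
  · have : Agree n (shift^[j] (splice k y x)) (shift^[j] y) :=
      Agree.shift_iterate ((splice_agree_add h).mono (by omega))
    rw [agree_iff_pref_eq.1 this]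
    exact hy j
  · obtain ⟨l, rfl⟩ : ∃ l, j = l + k := ⟨j - k, by omega⟩
    rw [Function.iterate_add_apply, shift_splice]
    exact hx l

/-- The class of the words that communicate with `u`. -/
def commClass (A : Set (Word n)) (u : Word (n - 1)) : Set (Word (n - 1)) :=
  {v | Relation.TransGen (Trans A) u v ∧ Relation.TransGen (Trans A) v u}

/-- The piece of `sft A` given by the class of `u`. -/
def piece (A : Set (Word n)) (u : Word (n - 1)) : Set Seq :=
  {t ∈ sft A | ∀ m : ℕ, pref (n - 1) (shift^[m] t) ∈ commClass A u}

variable {u : Word (n - 1)}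

theorem shift_mem_piece {t : Seq} (ht : t ∈ piece A u) : shift t ∈ piece A u :=
  ⟨fun m => ht.1 (m + 1), fun m => ht.2 (m + 1)⟩

theorem cons_mem_piece (hn : 1 ≤ n) {x : Seq} (hx : x ∈ piece A u) {v : Word (n - 1)}
    (hv : v ∈ commClass A u) (htr : Trans A v (pref (n - 1) x)) :
    ∃ z ∈ piece A u, pref (n - 1) z = v ∧ shift z = x := by
  obtain ⟨a, ha, hva, hxa⟩ := htr
  set z : Seq := app (fun _ : Fin 1 => a ⟨0, hn⟩) x with hz
  have hzx : shift z = x := shift_app (fun _ : Fin 1 => a ⟨0, hn⟩) x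
  have hz0 : ∀ i (hi : i < n), z i = a ⟨i, hi⟩ := by
    intro i hi
    rcases i with _ | i
    · simp [hz, app]
    · have := hxa ⟨i, by omega⟩
      simp only [pref] at this
      rw [← this, ← hzx]; rfl
  have hzn : pref n z = a := funext fun i => hz0 i i.2
  have hzv : pref (n - 1) z = v := by
    funext i
    rw [hva i]
    exact hz0 i (by omega)
  refine ⟨z, ⟨fun m => ?_, fun m => ?_⟩, hzv, hzx⟩
  · rcases m with _ | m
    · rw [Function.iterate_zero, id, hzn]; exact ha
    · rw [Function.iterate_succ_apply, hzx]; exact hx.1 m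
  · rcases m with _ | m
    · rw [Function.iterate_zero, id, hzv]; exact hv
    · rw [Function.iterate_succ_apply, hzx]; exact hx.2 m

/-- The path is followed backwards from `x`, prepending one letter per edge. Its vertices are
reachable from `u` and lead to `x`, hence back to `u`, so they stay in the class. -/
theorem exists_link_piece (hn : 1 ≤ n) {x : Seq} (hx : x ∈ piece A u) {v : Word (n - 1)}
    (hv : Relation.TransGen (Trans A) u v)
    (htr : Relation.TransGen (Trans A) v (pref (n - 1) x)) :
    ∃ r, ∃ z ∈ piece A u, pref (n - 1) z = v ∧ shift^[r] z = x := by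
  have hxu := (hx.2 0).2
  induction htr using Relation.TransGen.head_induction_on with
  | single h =>
    obtain ⟨z, hz, hzv, hzx⟩ := cons_mem_piece hn hx ⟨hv, Relation.TransGen.head h hxu⟩ h
    exact ⟨1, z, hz, hzv, hzx⟩
  | head h h' ih =>
    obtain ⟨r, z, hz, hzv, hzx⟩ := ih (hv.tail h)
    rw [← hzv] at h h'
    obtain ⟨z', hz', hzv', hzx'⟩ := cons_mem_piece hn hz
      ⟨hv, Relation.TransGen.head h (h'.trans hxu)⟩ h
    exact ⟨r + 1, z', hz', hzv', by rw [Function.iterate_succ_apply, hzx', hzx]⟩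

/-- Each vertex of the class has a successor in the class. Along an infinite path the edge words
overlap in `n - 1` letters, so their first letters spell a point of the piece. -/
theorem piece_nonempty (hn : 1 ≤ n) (hu : Relation.TransGen (Trans A) u u) :
    (piece A u).Nonempty := by
  have hstep : ∀ v : commClass A u, ∃ w : commClass A u, Trans A v.1 w.1 := by
    rintro ⟨v, hv1, hv2⟩
    rcases (Relation.TransGen.head'_iff.1 hv2) with ⟨w, hw1, hw2⟩
    refine ⟨⟨w, hv1.tail hw1, ?_⟩, hw1⟩
    rcases Relation.reflTransGen_iff_eq_or_transGen.1 hw2 with rfl | h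
    · exact hu
    · exact h
  choose next hnext using hstep
  set p : ℕ → commClass A u := fun i => next^[i] ⟨u, hu, hu⟩ with hp
  have hpt : ∀ i, Trans A (p i).1 (p (i + 1)).1 := by
    intro i
    simp only [hp, Function.iterate_succ_apply']
    exact hnext _
  choose a haA hpa hpa' using hpt
  have key : ∀ (j : ℕ) (hj : j < n) (i : ℕ), a i ⟨j, hj⟩ = a (i + j) ⟨0, hn⟩ := by
    intro j
    induction j with
    | zero => intro _ _; rfl
    | succ j ih =>
      intro hj i
      have h1 := hpa' i ⟨j, by omega⟩
      have h2 := hpa (i + 1) ⟨j, by omega⟩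
      have h3 := ih (by omega) (i + 1)
      have e : i + 1 + j = i + (j + 1) := by omega
      rw [e] at h3
      rw [← h3]
      exact h1.symm.trans h2
  have hpref : ∀ i, pref n (shift^[i] (fun l => a l ⟨0, hn⟩)) = a i := by
    intro i
    funext j
    simp only [pref, iterate_shift_apply]
    rw [add_comm, ← key j j.2 i]
  refine ⟨fun l => a l ⟨0, hn⟩, fun m => by rw [hpref]; exact haA m, fun m => ?_⟩
  have : pref (n - 1) (shift^[m] (fun l => a l ⟨0, hn⟩)) = (p m).1 := by
    funext j
    rw [hpa m j, ← hpref m]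
    rfl
  rw [this]
  exact (p m).2

theorem exists_isTransitiveMarkov_piece (hn : 1 ≤ n) (hu : Relation.TransGen (Trans A) u u) :
    ∃ R, IsTransitiveMarkov (n - 1) R (piece A u) := by
  refine isTransitiveMarkov_of_exists_link (piece_nonempty hn hu) (fun x => shift_mem_piece) ?_ ?_
  · intro k y hy x hx h
    refine ⟨mem_sft_splice hy.1 hx.1 h, fun j => ?_⟩
    by_cases hj : j < k
    · have : Agree (n - 1) (shift^[j] (splice k y x)) (shift^[j] y) :=
        Agree.shift_iterate ((splice_agree_add h).mono (by omega))
      rw [agree_iff_pref_eq.1 this]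
      exact hy.2 j
    · obtain ⟨l, rfl⟩ : ∃ l, j = l + k := ⟨j - k, by omega⟩
      rw [Function.iterate_add_apply, shift_splice]
      exact hx.2 l
  · intro x hx y hy
    obtain ⟨r, z, hz, hzy, hzx⟩ := exists_link_piece hn hx (hy.2 0).1
      ((hy.2 0).2.trans (hx.2 0).1)
    exact ⟨r, z, hz, agree_iff_pref_eq.2 hzy, hzx⟩

/-- Each vertex of the class has a predecessor in the class. -/
theorem exists_preimage_piece (hn : 1 ≤ n) (hu : Relation.TransGen (Trans A) u u) (L : ℕ) {x : Seq}
    (hx : x ∈ piece A u) : ∃ y ∈ piece A u, shift^[L] y = x := by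
  induction L with
  | zero => exact ⟨x, hx, rfl⟩
  | succ L ih =>
    obtain ⟨y, hy, hyx⟩ := ih
    obtain ⟨v, hv1, hv2⟩ := Relation.TransGen.tail'_iff.1 (hy.2 0).1
    have hvu : Relation.TransGen (Trans A) u v := by
      rcases Relation.reflTransGen_iff_eq_or_transGen.1 hv1 with rfl | h
      · exact hu
      · exact h
    obtain ⟨z, hz, -, hzy⟩ := cons_mem_piece hn hy ⟨hvu, Relation.TransGen.head hv2 (hy.2 0).2⟩ hv2
    exact ⟨z, hz, by rw [Function.iterate_succ_apply, hzy, hyx]⟩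

/-! ### Free concatenations of words that avoid the forbidden words -/

/-- The words of length `M` that occur in a word of length `n` outside `A`. -/
def badWords (A : Set (Word n)) (M : ℕ) : Set (Word M) :=
  {w | ∃ v, v ∉ A ∧ ∃ (j : ℕ) (hj : j + M ≤ n), ∀ i : Fin M, w i = v ⟨j + i, by omega⟩}

/-- The infinite concatenations of words of length `M` outside `badWords A M`. -/
def freeShift (A : Set (Word n)) (M : ℕ) : Set Seq :=
  {t | ∀ j, pref M (shift^[j * M] t) ∉ badWords A M}

variable {M : ℕ}

/-- All subwords of length `M` of a forbidden word are bad, so one good subword certifies a window.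
-/
theorem mem_sft_of_forall_window {t : Seq} (h : ∀ m, pref n (shift^[m] t) ∈ A ∨
    ∃ p, m ≤ p ∧ p + M ≤ m + n ∧ pref M (shift^[p] t) ∉ badWords A M) : t ∈ sft A := by
  intro m
  rcases h m with h | ⟨p, hmp, hpM, hp⟩
  · exact h
  · by_contra hA
    refine hp ⟨_, hA, p - m, by omega, fun i => ?_⟩
    simp only [pref, iterate_shift_apply]
    congr 1
    omega

theorem exists_mul_between (hM : 1 ≤ M) (m : ℕ) : ∃ q, m ≤ q * M ∧ q * M < m + M := by
  refine ⟨(m + M - 1) / M, ?_, ?_⟩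
  · have h1 := Nat.div_add_mod (m + M - 1) M
    have h2 := Nat.mod_lt (m + M - 1) hM
    rw [mul_comm] at h1
    omega
  · have := Nat.div_mul_le_self (m + M - 1) M
    omega

theorem freeShift_subset_sft (hM : 1 ≤ M) (hMn : 2 * M ≤ n) : freeShift A M ⊆ sft A := by
  intro t ht
  refine mem_sft_of_forall_window (M := M) fun m => Or.inr ?_
  obtain ⟨q, h1, h2⟩ := exists_mul_between hM m
  exact ⟨q * M, h1, by omega, ht q⟩

theorem pref_shift_splice_left {M p k : ℕ} (h : p + M ≤ k) (y x : Seq) :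
    pref M (shift^[p] (splice k y x)) = pref M (shift^[p] y) :=
  agree_iff_pref_eq.1 (Agree.shift_iterate ((splice_agree k y x).mono (by omega)))

/-- The good prefix of `x` serves as one more block for the windows that cross the junction. -/
theorem splice_freeShift_mem_sft (hM : 1 ≤ M) (hMn : 2 * M ≤ n) {t x : Seq}
    (ht : t ∈ freeShift A M) (hx : x ∈ sft A) (hx0 : pref M x ∉ badWords A M) (j : ℕ) :
    splice (j * M) t x ∈ sft A := by
  refine mem_sft_of_forall_window (M := M) fun m => ?_
  by_cases hm : j * M ≤ m
  · left
    obtain ⟨l, rfl⟩ : ∃ l, m = l + j * M := ⟨m - j * M, by omega⟩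
    rw [Function.iterate_add_apply, shift_splice]
    exact hx l
  · right
    obtain ⟨q, h1, h2⟩ := exists_mul_between hM m
    refine ⟨q * M, h1, by omega, ?_⟩
    have hq : q ≤ j := by
      by_contra! hq
      have : (j + 1) * M ≤ q * M := Nat.mul_le_mul_right M hq
      rw [add_mul, one_mul] at this
      omega
    rcases hq.eq_or_lt with rfl | hq
    · rw [shift_splice]; exact hx0
    · have : (q + 1) * M ≤ j * M := Nat.mul_le_mul_right M hq
      rw [add_mul, one_mul] at this
      rw [pref_shift_splice_left this]
      exact ht q

/-- A window crossing the junction contains the good word of `y` at `L` or the first block of `t` at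
`L + M`, because `2 * M ≤ n`. -/
theorem splice_mem_sft_freeShift (hM : 1 ≤ M) (hMn : 2 * M ≤ n) {t y : Seq}
    (ht : t ∈ freeShift A M) (hy : y ∈ sft A) {L : ℕ}
    (hyL : pref M (shift^[L] y) ∉ badWords A M) : splice (L + M) y t ∈ sft A := by
  refine mem_sft_of_forall_window (M := M) fun m => ?_
  by_cases h1 : m + n ≤ L + M
  · left
    rw [pref_shift_splice_left h1]
    exact hy m
  by_cases h2 : m ≤ L
  · right
    refine ⟨L, h2, by omega, ?_⟩
    rw [pref_shift_splice_left le_rfl]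
    exact hyL
  by_cases h3 : m < L + M
  · right
    refine ⟨L + M, h3.le, by omega, ?_⟩
    rw [shift_splice]
    simpa using ht 0
  · left
    obtain ⟨l, rfl⟩ : ∃ l, m = l + (L + M) := ⟨m - (L + M), by omega⟩
    rw [Function.iterate_add_apply, shift_splice]
    exact freeShift_subset_sft hM hMn ht l

/-- A piece containing a word of length `M` outside `badWords A M` contains all the free
concatenations of such words. -/
theorem freeShift_subset_piece (hM : 1 ≤ M) (hMn : 2 * M ≤ n)
    (hu : Relation.TransGen (Trans A) u u) {x : Seq} (hx : x ∈ piece A u)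
    (hx0 : pref M x ∉ badWords A M) : freeShift A M ⊆ piece A u := by
  intro t ht
  refine ⟨freeShift_subset_sft hM hMn ht, fun m => ⟨?_, ?_⟩⟩
  · obtain ⟨y, hy, hyx⟩ := exists_preimage_piece (by omega) hu n hx
    have hs : splice (n + M) y t ∈ sft A :=
      splice_mem_sft_freeShift hM hMn ht hy.1 (by rw [hyx]; exact hx0)
    have h1 := transGen_pref_shift hs (i := 0) (j := m + (n + M)) (by omega)
    rw [pref_shift_splice_left (by omega), Function.iterate_add_apply, shift_splice] at h1
    exact (hy.2 0).1.trans h1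
  · have hs := splice_freeShift_mem_sft hM hMn ht hx.1 hx0 (m + n)
    have hle : m + n ≤ (m + n) * M := Nat.le_mul_of_pos_right _ hM
    have h1 := transGen_pref_shift hs (i := m) (j := (m + n) * M) (by omega)
    rw [pref_shift_splice_left (by omega), shift_splice] at h1
    exact h1.trans (hx.2 0).2

theorem app_mem_freeShift {w : Word M} (hw : w ∉ badWords A M) {x : Seq} (hx : x ∈ freeShift A M) :
    app w x ∈ freeShift A M := by
  intro j
  rcases j with _ | j
  · rw [zero_mul, Function.iterate_zero, id, pref_app]; exact hw
  · rw [add_mul, one_mul, Function.iterate_add_apply, shift_app]; exact hx j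

theorem freeShift_nonempty {w : Word M} (hw : w ∉ badWords A M) :
    (freeShift A M).Nonempty := by
  rcases M.eq_zero_or_pos with rfl | hM
  · refine ⟨0, fun j => ?_⟩
    convert hw
  refine ⟨fun i => w ⟨i % M, Nat.mod_lt _ hM⟩, fun j => ?_⟩
  convert hw
  funext i
  simp only [pref, iterate_shift_apply]
  congr 1
  ext
  simp [Nat.mod_eq_of_lt i.2]

/-- A bad word is determined by a forbidden word and a starting position. -/
theorem ncard_badWords_le (A : Set (Word n)) (M : ℕ) :
    (badWords A M).ncard ≤ (Aᶜ : Set (Word n)).ncard * (n + 1) := by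
  classical
  set F : Word n × Fin (n + 1) → Word M := fun p i =>
    if h : (p.2 : ℕ) + i < n then p.1 ⟨p.2 + i, h⟩ else 0 with hF
  have hsub : badWords A M ⊆ F '' ((Aᶜ : Set (Word n)) ×ˢ univ) := by
    rintro w ⟨v, hv, j, hj, hw⟩
    refine ⟨(v, ⟨j, by omega⟩), ⟨hv, mem_univ _⟩, ?_⟩
    funext i
    have : j + (i : ℕ) < n := by omega
    simp only [hF, this, dif_pos]
    exact (hw i).symm
  refine (Set.ncard_le_ncard hsub (Set.toFinite _)).trans ((Set.ncard_image_le (Set.toFinite _)).trans ?_)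
  rw [Set.ncard_prod, Set.ncard_univ, Nat.card_eq_fintype_card, Fintype.card_fin]

end Piece

/-! ### The number of forbidden words -/

/-- Letters are reversed because `finFunctionFinEquiv` puts the least significant digit first. -/
theorem lam_eq (k : ℕ) (w : Word k) :
    lam w * 2 ^ k = ((finFunctionFinEquiv (w ∘ Fin.rev) : Fin (2 ^ k)) : ℕ) := by
  rw [finFunctionFinEquiv_apply, ← Equiv.sum_comp Fin.revPerm]
  unfold lam
  rw [Finset.sum_mul]
  push_cast
  refine Finset.sum_congr rfl fun i _ => ?_
  simp only [Fin.revPerm_apply, Function.comp, Fin.rev_rev, Fin.val_rev]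
  rw [mul_assoc]
  congr 1
  have hi := i.2
  have e : (2 : ℝ) ^ k = 2 ^ ((i : ℕ) + 1) * 2 ^ (k - ((i : ℕ) + 1)) := by
    rw [← pow_add]; congr 1; omega
  rw [e, ← mul_assoc, ← mul_pow]
  simp

theorem lam_forbiddenAt {k : ℕ} {x : ℝ} {w : Word k} (hw : w ∈ forbiddenAt k x) :
    x * 2 ^ k - 2 ≤ lam w * 2 ^ k ∧ lam w * 2 ^ k ≤ x * 2 ^ k := by
  obtain ⟨v, hv, hvw⟩ := hw
  have h2 : (0 : ℝ) < 2 ^ k := by positivity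
  have h3 : ((1 : ℝ) / 2) ^ k * 2 ^ k = 1 := by rw [← mul_pow]; norm_num
  have hx : x * 2 ^ k - 1 ≤ lam v * 2 ^ k ∧ lam v * 2 ^ k ≤ x * 2 ^ k := by
    rcases hv with ⟨-, h4, h5⟩ | ⟨rfl, h4⟩
    · constructor <;> nlinarith
    · have : lam v = 1 - (1 / 2) ^ k := by
        unfold lam
        have e : ∀ m : ℕ, ∑ i ∈ Finset.range m, ((1 : ℝ) / 2) ^ (i + 1) = 1 - (1 / 2) ^ m := by
          intro m
          induction m with
          | zero => simp
          | succ m ih => rw [Finset.sum_range_succ, ih, pow_succ]; ring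
        rw [← e k, ← Fin.sum_univ_eq_sum_range (fun i => ((1 : ℝ) / 2) ^ (i + 1))]
        exact Finset.sum_congr rfl fun i _ => by simp [h4 i]
      rw [this]
      constructor <;> nlinarith
  rcases hvw with ⟨-, rfl⟩ | ⟨-, h4, h5⟩
  · exact ⟨by linarith [hx.1], hx.2⟩
  · constructor <;> nlinarith [hx.1, hx.2]

/-- The integer `lam w * 2 ^ k` determines `w`, and by `lam_forbiddenAt` it lies in an interval of
length `2`. -/
theorem ncard_forbiddenAt_le (k : ℕ) (x : ℝ) : (forbiddenAt k x).ncard ≤ 3 := by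
  set f : Word k → ℤ := fun w => ((finFunctionFinEquiv (w ∘ Fin.rev) : Fin (2 ^ k)) : ℕ) with hf
  have hinj : Function.Injective f := by
    intro w w' h
    simp only [hf, Nat.cast_inj, Fin.val_inj, EmbeddingLike.apply_eq_iff_eq] at h
    funext i
    simpa using congrFun h (Fin.rev i)
  have hmaps : ∀ w ∈ forbiddenAt k x, f w ∈
      ((Finset.Icc (⌊x * 2 ^ k⌋ - 2) ⌊x * 2 ^ k⌋ : Finset ℤ) : Set ℤ) := by
    intro w hw
    have h := lam_forbiddenAt hw
    rw [lam_eq] at h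
    simp only [Finset.coe_Icc, mem_Icc]
    have e : ((f w : ℤ) : ℝ) = ((finFunctionFinEquiv (w ∘ Fin.rev) : Fin (2 ^ k)) : ℕ) := by
      simp [hf]
    rw [← e] at h
    refine ⟨?_, Int.le_floor.2 h.2⟩
    have : ⌊x * 2 ^ k⌋ ≤ f w + 2 := by
      have h1 := Int.floor_le (x * 2 ^ k)
      have : ((⌊x * 2 ^ k⌋ : ℤ) : ℝ) ≤ ((f w + 2 : ℤ) : ℝ) := by push_cast; linarith
      exact_mod_cast this
    omega
  refine (Set.ncard_le_ncard_of_injOn f hmaps hinj.injOn (Finset.finite_toSet _)).trans ?_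
  rw [Set.ncard_coe_finset, Int.card_Icc]
  omega

theorem ncard_compl_admissible_le {ψ : ℝ → ℝ} (hψ : (zeros ψ).Finite) (k : ℕ) :
    ((admissible ψ k)ᶜ : Set (Word k)).ncard ≤ 3 * (zeros ψ).ncard := by
  classical
  have hsub : ((admissible ψ k)ᶜ : Set (Word k)) =
      ⋃ x ∈ hψ.toFinset, forbiddenAt k x := by
    ext w
    simp [admissible]
  rw [hsub]
  refine (Finset.set_ncard_biUnion_le _ _).trans ?_
  refine (Finset.sum_le_sum fun x _ => ncard_forbiddenAt_le k x).trans ?_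
  rw [Finset.sum_const, smul_eq_mul, mul_comm, Set.ncard_eq_toFinset_card _ hψ]

end WaveletShift

namespace WaveletShift

/-! ### Comparison of the pressure with that of the full shift -/

section

variable {m R : ℕ} {X : Set Seq} {g : Seq → ℝ} {C θ B : ℝ}

theorem IsTransitiveMarkov.pressure_le_univ (hX : IsTransitiveMarkov m R X) (hg : Regular g C θ)
    (hθ0 : 0 ≤ θ) (hθ1 : θ < 1) : pressure X g ≤ pressure univ g := by
  obtain ⟨x, hx⟩ := hX.nonempty
  obtain ⟨c, hc, h⟩ := hX.exists_pressure_bounds C hθ0 hθ1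
  obtain ⟨c', hc', h'⟩ := isTransitiveMarkov_univ.exists_pressure_bounds C hθ0 hθ1
  have hc0 : 0 < c := by linarith
  refine le_of_exp_nat_mul_le (K := c * c') fun n => ?_
  have h1 := ((h g hg).2 n x hx).1
  have h2 := ((h' g hg).2 n x (mem_univ x)).2
  have h3 : op X g n 1 x ≤ op univ g n 1 x := by
    refine Finset.sum_le_sum_of_subset_of_nonneg ?_ fun y _ _ => by simp [Real.exp_nonneg]
    intro y hy
    rw [mem_pre] at hy ⊢
    exact ⟨mem_univ _, hy.2⟩
  rw [inv_mul_le_iff₀ hc0] at h1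
  calc _ ≤ c * op X g n 1 x := h1
    _ ≤ c * (c' * Real.exp (n * pressure univ g)) := by gcongr; exact h3.trans h2
    _ = _ := by ring

theorem app_injective {n : ℕ} (x : Seq) : Function.Injective (fun w : Word n => app w x) := by
  intro w w' h
  have := congrArg (pref n) h
  simpa only [pref_app] using this

theorem op_univ_eq_sum (g : Seq → ℝ) (n : ℕ) (x : Seq) :
    op univ g n 1 x = ∑ w : Word n, Real.exp (birkhoffSum shift g n (app w x)) := by
  classical
  have e : pre univ n x = Finset.univ.image (fun w : Word n => app w x) := by
    ext y
    simp only [mem_pre, mem_univ, true_and, Finset.mem_image, Finset.mem_univ]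
    exact ⟨fun h => ⟨pref n y, by rw [← h, app_pref_shift]⟩, by rintro ⟨w, rfl⟩; exact shift_app _ _⟩
  unfold op
  rw [e, Finset.sum_image (app_injective x).injOn]
  simp

/-- The weight of a single word is exponentially small, relative to the sum over all words. -/
theorem pow_mul_exp_le_op_univ (hg : Regular g C θ) (hθ0 : 0 ≤ θ) (hθ1 : θ ≤ 1) (hB0 : 0 ≤ B)
    (hB : C ≤ B * (1 - θ)) (n : ℕ) (x : Seq) :
    (1 + Real.exp (-(B + 2 * C))) ^ n * Real.exp (birkhoffSum shift g n x) ≤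
      op univ g n 1 (shift^[n] x) := by
  classical
  induction n with
  | zero => simp [op_zero_apply, birkhoffSum]
  | succ n ih =>
    set z := shift^[n] x with hz
    -- `z'` is the other preimage of `shift z`. Its share is at least `exp (-(B + 2 * C))` times
    -- that of `z`: `2 * C` for the two values of `g`, `B` for those of `op univ g n 1`.
    set z' : Seq := app (fun _ : Fin 1 => z 0 + 1) (shift z) with hz'
    have hzz' : shift z' = shift z := shift_app (fun _ : Fin 1 => z 0 + 1) (shift z)
    have hne : z' ≠ z := by
      intro h
      have := congrFun h 0
      simp only [hz', app, zero_lt_one, dif_pos] at this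
      have h2 : ∀ a : Fin 2, a + 1 ≠ a := by decide
      exact h2 _ this
    have h1 : Real.exp (g z) * op univ g n 1 z + Real.exp (g z') * op univ g n 1 z' ≤
        op univ g 1 (op univ g n 1) (shift z) := by
      unfold op
      have hsub : ({z, z'} : Finset Seq) ⊆ pre univ 1 (shift z) := by
        intro y hy
        rw [mem_pre]
        simp only [Finset.mem_insert, Finset.mem_singleton] at hy
        rcases hy with rfl | rfl
        · exact ⟨mem_univ _, rfl⟩
        · exact ⟨mem_univ _, hzz'⟩
      refine le_trans (le_of_eq ?_) (Finset.sum_le_sum_of_subset_of_nonneg hsub fun y _ _ =>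
        mul_nonneg (Real.exp_nonneg _) (Finset.sum_nonneg fun y _ => by simp [Real.exp_nonneg]))
      rw [Finset.sum_pair hne.symm, birkhoffSum_one, birkhoffSum_one]
    have h2 := isTransitiveMarkov_univ.op_one_le_mul hg hθ0 hθ1 hB0 hB n (mem_univ z) (mem_univ z')
    have e1 : sumBound C 0 = 1 := by simp [sumBound]
    rw [e1, Nat.cast_zero, zero_mul, add_zero, mul_one] at h2
    have h3 : Real.exp (-(B + 2 * C)) * (Real.exp (g z) * op univ g n 1 z) ≤
        Real.exp (g z') * op univ g n 1 z' := by
      have h4 : Real.exp (-(B + 2 * C)) * Real.exp (g z) * Real.exp B ≤ Real.exp (g z') := by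
        rw [← Real.exp_add, ← Real.exp_add]
        refine Real.exp_le_exp.2 ?_
        have := (abs_le.1 (hg.bound z)).2
        have := (abs_le.1 (hg.bound z')).1
        linarith
      have hnn : 0 ≤ op univ g n 1 z' := op_nonneg _ _ (fun _ _ => zero_le_one) _
      calc _ ≤ Real.exp (-(B + 2 * C)) * (Real.exp (g z) * (Real.exp B * op univ g n 1 z')) := by
            gcongr
        _ = (Real.exp (-(B + 2 * C)) * Real.exp (g z) * Real.exp B) * op univ g n 1 z' := by ring
        _ ≤ _ := by gcongr
    rw [Function.iterate_succ_apply', op_add (fun _ _ => mem_univ _), birkhoffSum_succ,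
      Real.exp_add, pow_succ]
    calc _ = (1 + Real.exp (-(B + 2 * C))) * (Real.exp (g z) *
          ((1 + Real.exp (-(B + 2 * C))) ^ n * Real.exp (birkhoffSum shift g n x))) := by ring
      _ ≤ (1 + Real.exp (-(B + 2 * C))) * (Real.exp (g z) * op univ g n 1 z) := by gcongr
      _ ≤ _ := by rw [add_mul, one_mul]; linarith

variable {n M : ℕ} {A : Set (Word n)}

-- Any good word can be prepended to a point of `freeShift`, so each of `J` blocks contributes at
-- least `exp (-B) * E`, where `B` pays for changing the tail `z`. The comparison constant of `X`
-- disappears as `J` grows, so nothing depends on `R`.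
open Classical in
theorem IsTransitiveMarkov.log_sum_le_pressure (hX : IsTransitiveMarkov m R X) (hg : Regular g C θ)
    (hθ0 : 0 ≤ θ) (hθ1 : θ < 1) (hB0 : 0 ≤ B) (hB : C ≤ B * (1 - θ))
    (hsub : freeShift A M ⊆ X) {E : ℝ} (hE0 : 0 < E) {z : Seq}
    (hE : E ≤ ∑ w : Word M with w ∉ badWords A M, Real.exp (birkhoffSum shift g M (app w z))) :
    Real.log E - B ≤ M * pressure X g := by
  have hne : (freeShift A M).Nonempty := by
    by_contra hne
    have hall : ∀ w : Word M, ¬ (w ∉ badWords A M) := fun w hw => hne (freeShift_nonempty hw)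
    rw [Finset.sum_eq_zero fun w hw => absurd (Finset.mem_filter.1 hw).2 (hall w)] at hE
    linarith
  obtain ⟨x₀, hx₀⟩ := hne
  obtain ⟨c, hc, h⟩ := hX.exists_pressure_bounds C hθ0 hθ1
  have key : ∀ J : ℕ, ∀ x ∈ freeShift A M, (Real.exp (-B) * E) ^ J ≤ op X g (J * M) 1 x := by
    intro J
    induction J with
    | zero => intro x hx; rw [zero_mul, op_zero_apply _ _ (hsub hx)]; simp
    | succ J ih =>
      intro x hx
      rw [add_mul, one_mul, op_add hX.shift_mem]
      have himg : ((Finset.univ.filter (fun w : Word M => w ∉ badWords A M)).image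
          (fun w => app w x)) ⊆ pre X M x := by
        intro y hy
        obtain ⟨w, hw, rfl⟩ := Finset.mem_image.1 hy
        rw [mem_pre]
        exact ⟨hsub (app_mem_freeShift (Finset.mem_filter.1 hw).2 hx), shift_app _ _⟩
      have hnn : ∀ y, 0 ≤ op X g (J * M) 1 y := fun y => op_nonneg _ _ (fun _ _ => zero_le_one) y
      calc (Real.exp (-B) * E) ^ (J + 1)
          ≤ (Real.exp (-B) * E) ^ J * (Real.exp (-B) * ∑ w : Word M with w ∉ badWords A M,
              Real.exp (birkhoffSum shift g M (app w z))) := by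
            rw [pow_succ]; gcongr
        _ = ∑ w : Word M with w ∉ badWords A M, (Real.exp (-B) *
              Real.exp (birkhoffSum shift g M (app w z))) * (Real.exp (-B) * E) ^ J := by
            rw [Finset.mul_sum, Finset.mul_sum]
            exact Finset.sum_congr rfl fun w _ => by ring
        _ ≤ ∑ w : Word M with w ∉ badWords A M,
              Real.exp (birkhoffSum shift g M (app w x)) * op X g (J * M) 1 (app w x) := by
            refine Finset.sum_le_sum fun w hw => ?_
            refine mul_le_mul ?_ (ih _ (app_mem_freeShift (Finset.mem_filter.1 hw).2 hx))
              (by positivity) (Real.exp_nonneg _)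
            rw [← Real.exp_add]
            refine Real.exp_le_exp.2 ?_
            have := (abs_le.1 (hg.birkhoffSum_sub_le_const hθ0 hθ1.le hB0 hB M
              (agree_iff_pref_eq.2 ((pref_app w z).trans (pref_app w x).symm)))).2
            linarith
        _ = ∑ y ∈ (Finset.univ.filter (fun w : Word M => w ∉ badWords A M)).image
              (fun w => app w x), Real.exp (birkhoffSum shift g M y) * op X g (J * M) 1 y :=
            (Finset.sum_image (f := fun y => Real.exp (birkhoffSum shift g M y) *
              op X g (J * M) 1 y) (app_injective x).injOn).symm
        _ ≤ _ := Finset.sum_le_sum_of_subset_of_nonneg himg fun y _ _ =>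
            mul_nonneg (Real.exp_nonneg _) (hnn y)
  refine le_of_exp_nat_mul_le (K := c) fun J => ?_
  have h1 := (key J x₀ hx₀).trans ((h g hg).2 (J * M) x₀ (hsub hx₀)).2
  rw [Real.exp_nat_mul, Real.exp_sub, Real.exp_log hE0]
  rw [Real.exp_neg] at h1
  push_cast at h1
  rw [mul_assoc] at h1
  rwa [div_eq_inv_mul]

/-- If there are few bad words, the pressure on a set containing `freeShift A M` is close to that of
the full shift. -/
theorem IsTransitiveMarkov.pressure_univ_le (hX : IsTransitiveMarkov m R X) (hg : Regular g C θ)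
    (hθ0 : 0 ≤ θ) (hθ1 : θ < 1) (hB0 : 0 ≤ B) (hB : C ≤ B * (1 - θ)) {c : ℝ} (hc : 1 ≤ c)
    (hbd : ∀ n : ℕ, ∀ x : Seq, c⁻¹ * Real.exp (n * pressure univ g) ≤ op univ g n 1 x)
    (hsub : freeShift A M ⊆ X)
    (hbad : 2 * ((badWords A M).ncard : ℝ) ≤ (1 + Real.exp (-(B + 2 * C))) ^ M) :
    M * pressure univ g ≤ M * pressure X g + (B + Real.log (2 * c)) := by
  classical
  have hc0 : 0 < c := by linarith
  set z : Seq := 0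
  set T := op univ g M 1 z with hT
  have hT1 := hbd M z
  have hT0 : 0 < T := lt_of_lt_of_le (by positivity) hT1
  set ρ := (1 + Real.exp (-(B + 2 * C))) ^ M with hρ
  have hρ0 : 0 < ρ := by positivity
  have hw : ∀ w : Word M, Real.exp (birkhoffSum shift g M (app w z)) ≤ T / ρ := by
    intro w
    have := pow_mul_exp_le_op_univ hg hθ0 hθ1.le hB0 hB M (app w z)
    rw [shift_app] at this
    rw [le_div_iff₀ hρ0, mul_comm]
    exact this
  have hsplit := Finset.sum_filter_add_sum_filter_not (Finset.univ : Finset (Word M))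
    (fun w => w ∈ badWords A M) (fun w => Real.exp (birkhoffSum shift g M (app w z)))
  rw [← op_univ_eq_sum, ← hT] at hsplit
  have hbadsum : ∑ w : Word M with w ∈ badWords A M,
      Real.exp (birkhoffSum shift g M (app w z)) ≤ T / 2 := by
    calc _ ≤ ∑ w : Word M with w ∈ badWords A M, T / ρ := Finset.sum_le_sum fun w _ => hw w
      _ = (badWords A M).ncard * (T / ρ) := by
          rw [Finset.sum_const, nsmul_eq_mul, Set.ncard_eq_toFinset_card' , Set.toFinset_card,
            Fintype.card_subtype]
      _ ≤ ρ / 2 * (T / ρ) := by gcongr; linarith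
      _ = T / 2 := by field_simp
  have h1 := hX.log_sum_le_pressure hg hθ0 hθ1 hB0 hB hsub (E := T / 2) (by linarith) (z := z)
    (by linarith)
  have h2 : M * pressure univ g ≤ Real.log (T / 2) + Real.log (2 * c) := by
    rw [← Real.log_mul (by positivity) (by positivity), Real.le_log_iff_exp_le (by positivity)]
    rw [inv_mul_le_iff₀ hc0] at hT1
    calc _ ≤ c * T := hT1
      _ = _ := by ring
  linarith

end

end WaveletShift

namespace WaveletShift

/-! ### Box dimension and the number of words -/

theorem agree_iff_dist_le {n : ℕ} {x y : Seq} : Agree n x y ↔ dist x y ≤ (1 / 2) ^ n :=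
  PiNat.mem_cylinder_iff_dist_le

theorem agree_iff_edist_le {n : ℕ} {x y : Seq} {δ : ℝ≥0} (hδ : δ = (1 / 2) ^ n) :
    Agree n x y ↔ edist x y ≤ δ := by
  rw [edist_le_coe, ← NNReal.coe_le_coe, coe_nndist, agree_iff_dist_le, hδ]
  push_cast
  rfl

theorem coveringNumber_le_encard (X : Set Seq) {n : ℕ} {δ : ℝ≥0} (hδ : (1 / 2) ^ n ≤ δ) :
    Metric.coveringNumber δ X ≤ (pref n '' X).encard := by
  have hrep : ∀ w ∈ pref n '' X, ∃ x ∈ X, pref n x = w := fun w hw => hw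
  choose! rep hrepX hrep using hrep
  have hcov : Metric.IsCover δ X (rep '' (pref n '' X)) := by
    intro x hx
    refine ⟨rep (pref n x), mem_image_of_mem _ (mem_image_of_mem _ hx), ?_⟩
    have : Agree n x (rep (pref n x)) :=
      agree_iff_pref_eq.2 (hrep _ (mem_image_of_mem _ hx)).symm
    exact ((agree_iff_edist_le rfl).1 this).trans (by exact_mod_cast hδ)
  refine (hcov.coveringNumber_le_encard ?_).trans (encard_image_le _ _)
  rintro _ ⟨w, hw, rfl⟩
  exact hrepX w hw

/-- Closed balls of radius `2 ^ (-n)` are exactly cylinders, so a cover needs a centre for each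
word. -/
theorem encard_le_coveringNumber (X : Set Seq) (n : ℕ) {δ : ℝ≥0} (hδ : δ = (1 / 2) ^ n) :
    (pref n '' X).encard ≤ Metric.coveringNumber δ X := by
  refine le_iInf fun S => le_iInf fun _ => le_iInf fun hcov => ?_
  refine le_trans (encard_le_encard ?_) (encard_image_le (pref n) S)
  rintro _ ⟨x, hx, rfl⟩
  obtain ⟨y, hy, hxy⟩ := hcov hx
  exact ⟨y, hy, (agree_iff_pref_eq.1 ((agree_iff_edist_le hδ).2 hxy)).symm⟩

theorem ennreal_log_natCast {b : ℕ} (hb : b ≠ 0) :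
    ENNReal.log (b : ℝ≥0∞) = ((Real.log b : ℝ) : EReal) := by
  have := ENNReal.log_of_nnreal (x := (b : ℝ≥0)) (by exact_mod_cast hb)
  simpa using this

theorem ennreal_log_div_le {N : ℕ∞} {b : ℕ} (hb : b ≠ 0) (hN : N ≤ b) {d v : ℝ} (hd : 0 < d)
    (h : Real.log b ≤ d * v) : ENNReal.log (N : ℝ≥0∞) / ((d : ℝ) : EReal) ≤ (v : EReal) := by
  rw [EReal.div_le_iff_le_mul (by exact_mod_cast hd) (EReal.coe_ne_top d)]
  have h1 : (N : ℝ≥0∞) ≤ (b : ℝ≥0∞) := by exact_mod_cast hN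
  refine (ENNReal.log_le_log h1).trans ?_
  rw [ennreal_log_natCast hb]
  exact_mod_cast h

theorem le_ennreal_log_div {N : ℕ∞} {b : ℕ} (hb : b ≠ 0) (hN : b ≤ N) {d v : ℝ} (hd : 0 < d)
    (h : v * d ≤ Real.log b) : (v : EReal) ≤ ENNReal.log (N : ℝ≥0∞) / ((d : ℝ) : EReal) := by
  rw [EReal.le_div_iff_mul_le (by exact_mod_cast hd) (EReal.coe_ne_top d)]
  have h1 : (b : ℝ≥0∞) ≤ (N : ℝ≥0∞) := by exact_mod_cast hN
  refine le_trans ?_ (ENNReal.log_le_log h1)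
  rw [ennreal_log_natCast hb]
  exact_mod_cast h

/-- The decomposition of a word of length `J * M` into `J` words of length `M`. -/
def blocks (J M : ℕ) (w : Word (J * M)) (j : Fin J) (i : Fin M) : Fin 2 :=
  w ⟨j * M + i, by
    have h1 : (j + 1) * M ≤ J * M := Nat.mul_le_mul_right M j.2
    have h2 := i.2
    rw [add_mul, one_mul] at h1
    omega⟩

theorem blocks_injective (J M : ℕ) : Function.Injective (blocks J M) := by
  intro w w' h
  funext i
  have hM : 0 < M := Nat.pos_of_ne_zero fun h0 => by
    have := i.2
    simp [h0] at this
  have hJ : (i : ℕ) / M < J := Nat.div_lt_of_lt_mul (i.2.trans_eq (mul_comm J M))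
  have := congrFun (congrFun h ⟨i / M, hJ⟩) ⟨i % M, Nat.mod_lt _ hM⟩
  simp only [blocks] at this
  have e : (i : ℕ) / M * M + i % M = i := Nat.div_add_mod' _ _
  have e' : ∀ h, (⟨(i : ℕ) / M * M + i % M, h⟩ : Fin (J * M)) = i := fun h => Fin.ext e
  rwa [e'] at this

theorem blocks_pref (J M : ℕ) (t : Seq) (j : Fin J) :
    blocks J M (pref (J * M) t) j = pref M (shift^[j * M] t) := by
  funext i
  simp only [blocks, pref, iterate_shift_apply]
  congr 1
  omega

theorem encard_pref_le {X : Set Seq} (hX : ∀ x ∈ X, shift x ∈ X) {M : ℕ} {S : Finset (Word M)}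
    (hS : ∀ x ∈ X, pref M x ∈ S) (J : ℕ) : (pref (J * M) '' X).encard ≤ (S.card ^ J : ℕ) := by
  classical
  have hmaps : blocks J M '' (pref (J * M) '' X) ⊆ (Fintype.piFinset fun _ : Fin J => S) := by
    rintro _ ⟨_, ⟨x, hx, rfl⟩, rfl⟩
    simp only [Finset.mem_coe, Fintype.mem_piFinset]
    intro j
    rw [blocks_pref]
    exact hS _ (iterate_shift_mem hX _ hx)
  rw [← (blocks_injective J M).injOn.encard_image]
  refine (encard_le_encard hmaps).trans ?_
  rw [encard_coe_eq_coe_finsetCard, Fintype.card_piFinset_const]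

theorem le_encard_pref_freeShift {n : ℕ} {A : Set (Word n)} {M : ℕ} (hM : 1 ≤ M)
    {S : Finset (Word M)} (hS : ∀ w ∈ S, w ∉ badWords A M) (hSne : S.Nonempty) (J : ℕ) :
    (S.card ^ J : ℕ) ≤ (pref (J * M) '' freeShift A M).encard := by
  classical
  obtain ⟨w₀, hw₀⟩ := hSne
  have hsub : ((Fintype.piFinset fun _ : Fin J => S) : Set (Fin J → Word M)) ⊆
      blocks J M '' (pref (J * M) '' freeShift A M) := by
    intro c hc
    simp only [Finset.mem_coe, Fintype.mem_piFinset] at hc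
    set c' : ℕ → Word M := fun j => if h : j < J then c ⟨j, h⟩ else w₀ with hc'
    have hc'S : ∀ j, c' j ∈ S := by
      intro j
      simp only [hc']
      split_ifs with h
      · exact hc _
      · exact hw₀
    set t : Seq := fun i => c' (i / M) ⟨i % M, Nat.mod_lt _ hM⟩ with ht
    have hpref : ∀ j, pref M (shift^[j * M] t) = c' j := by
      intro j
      funext i
      simp only [pref, iterate_shift_apply, ht]
      have e1 : ((i : ℕ) + j * M) / M = j := by
        rw [Nat.add_mul_div_right _ _ hM, Nat.div_eq_of_lt i.2, zero_add]
      have e2 : ((i : ℕ) + j * M) % M = i := by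
        rw [Nat.add_mul_mod_self_right, Nat.mod_eq_of_lt i.2]
      rw [e1]
      congr 1
      exact Fin.ext e2
    refine ⟨pref (J * M) t, ⟨t, fun j => ?_, rfl⟩, ?_⟩
    · rw [hpref]; exact hS _ (hc'S j)
    · funext j
      rw [blocks_pref, hpref]
      simp [hc']
  have := encard_le_encard hsub
  rw [(blocks_injective J M).injOn.encard_image, encard_coe_eq_coe_finsetCard,
    Fintype.card_piFinset_const] at this
  exact this

/-- Words of length `J * M` seen in `X` are `J`-tuples from `S`. The crude factor `2` comes from
rounding the scale: for `δ` below `2 ^ (-M)` the index `j` is at least `1`, so `j + 1 ≤ 2 * j`. -/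
theorem upperBoxDim_le {X : Set Seq} (hX : ∀ x ∈ X, shift x ∈ X) {M : ℕ} (hM : 1 ≤ M)
    {S : Finset (Word M)} (hS : ∀ x ∈ X, pref M x ∈ S) (hSne : S.Nonempty) :
    upperBoxDim X ≤ ((2 * Real.log S.card / (M * Real.log 2) : ℝ) : EReal) := by
  have hM0 : (0 : ℝ) < M := by exact_mod_cast hM
  have hl2 : 0 < Real.log 2 := Real.log_pos (by norm_num)
  have hb1 : (1 : ℝ) ≤ S.card := by exact_mod_cast hSne.card_pos
  have hlb : 0 ≤ Real.log S.card := Real.log_nonneg hb1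
  refine limsup_le_of_le (by isBoundedDefault) ?_
  have hy0 : (0 : ℝ≥0) < (1 / 2) ^ M := by positivity
  have hev : ∀ᶠ δ : ℝ≥0 in 𝓝[>] 0, δ ∈ Ioo 0 ((1 / 2 : ℝ≥0) ^ M) := Ioo_mem_nhdsGT hy0
  filter_upwards [hev] with δ hδ
  have hy1 : (1 / 2 : ℝ≥0) ^ M < 1 := pow_lt_one₀ (by positivity) (by
    rw [div_lt_one (by norm_num)]; norm_num) (by omega)
  obtain ⟨j, hj1, hj2⟩ := exists_nat_pow_near_of_lt_one hδ.1 (hδ.2.le.trans hy1.le) hy0 hy1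
  have hj : 1 ≤ j := by
    by_contra! hj
    have : j = 0 := by omega
    subst this
    rw [zero_add, pow_one] at hj1
    exact absurd hj1 (not_lt.2 hδ.2.le)
  have hδ0 : (0 : ℝ) < δ := by exact_mod_cast hδ.1
  have hcov := (coveringNumber_le_encard X (n := (j + 1) * M) (δ := δ) (by
    rw [mul_comm, pow_mul]; exact hj1.le)).trans (encard_pref_le hX hS (j + 1))
  have hlogδ : j * (M * Real.log 2) ≤ -Real.log δ := by
    have h1 : (δ : ℝ) ≤ ((1 / 2) ^ M) ^ j := by exact_mod_cast hj2
    have h2 := Real.log_le_log hδ0 h1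
    rw [Real.log_pow, Real.log_pow, one_div, Real.log_inv] at h2
    linarith
  have hj0 : (1 : ℝ) ≤ j := by exact_mod_cast hj
  refine ennreal_log_div_le (by positivity) hcov (lt_of_lt_of_le (by positivity) hlogδ) ?_
  push_cast
  rw [Real.log_pow]
  push_cast
  calc ((j : ℝ) + 1) * Real.log S.card ≤ (2 * j) * Real.log S.card := by gcongr; linarith
    _ = j * (M * Real.log 2) * (2 * Real.log S.card / (M * Real.log 2)) := by field_simp
    _ ≤ _ := by gcongr

/-- For a lower bound on the limsup it is enough to test the scales `2 ^ (-(J * M))`. -/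
theorem le_upperBoxDim {n : ℕ} {A : Set (Word n)} {M : ℕ} (hM : 1 ≤ M) (hMn : 2 * M ≤ n)
    {S : Finset (Word M)} (hS : ∀ w ∈ S, w ∉ badWords A M) (hSne : S.Nonempty) :
    ((Real.log S.card / (M * Real.log 2) : ℝ) : EReal) ≤ upperBoxDim (sft A) := by
  have hM0 : (0 : ℝ) < M := by exact_mod_cast hM
  have hl2 : 0 < Real.log 2 := Real.log_pos (by norm_num)
  refine le_limsup_of_frequently_le ?_ (by isBoundedDefault)
  have htend : Tendsto (fun J : ℕ => (1 / 2 : ℝ≥0) ^ (J * M)) atTop (𝓝[>] 0) := by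
    refine tendsto_nhdsWithin_iff.2 ⟨?_, Eventually.of_forall fun J => by
      simp only [mem_Ioi]; positivity⟩
    refine (NNReal.tendsto_pow_atTop_nhds_zero_of_lt_one ?_).comp
      (tendsto_atTop_mono (fun J => Nat.le_mul_of_pos_right J hM) tendsto_id)
    rw [div_lt_one (by norm_num)]; norm_num
  refine htend.frequently (Eventually.frequently ?_)
  filter_upwards [eventually_gt_atTop 0] with J hJ
  have hJ0 : (0 : ℝ) < J := by exact_mod_cast hJ
  have hcov : ((S.card ^ J : ℕ) : ℕ∞) ≤ Metric.coveringNumber ((1 / 2 : ℝ≥0) ^ (J * M)) (sft A) :=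
    (le_encard_pref_freeShift hM hS hSne J).trans ((encard_le_encard
      (image_mono (freeShift_subset_sft hM hMn))).trans (encard_le_coveringNumber _ _ rfl))
  have hlog : -Real.log (((1 / 2 : ℝ≥0) ^ (J * M) : ℝ≥0) : ℝ) = J * (M * Real.log 2) := by
    push_cast
    rw [Real.log_pow, one_div, Real.log_inv]
    push_cast
    ring
  rw [hlog]
  have hc : S.card ≠ 0 := hSne.card_pos.ne'
  refine le_ennreal_log_div (pow_ne_zero _ hc) hcov (by positivity) (le_of_eq ?_)
  push_cast
  rw [Real.log_pow]
  field_simp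

/-- A piece of full dimension contains a word of length `M` which is not bad, if there are
sufficiently few bad words. -/
theorem exists_pref_notMem_badWords {n : ℕ} {A : Set (Word n)} {u : Word (n - 1)} {M : ℕ}
    (hM : 1 ≤ M) (hMn : 2 * M ≤ n) (hu : Relation.TransGen (Trans A) u u)
    (hdim : upperBoxDim (piece A u) = upperBoxDim (sft A))
    (hcard : (badWords A M).ncard ^ 2 + (badWords A M).ncard < 2 ^ M) :
    ∃ x ∈ piece A u, pref M x ∉ badWords A M := by
  classical
  by_contra! hall
  obtain ⟨x₀, hx₀⟩ := piece_nonempty (by omega) hu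
  set b := (badWords A M).ncard with hb
  set S : Finset (Word M) := (badWords A M).toFinset with hSdef
  have hScard : S.card = b := (Set.ncard_eq_toFinset_card' _).symm
  have hS : ∀ x ∈ piece A u, pref M x ∈ S := fun x hx => by
    rw [hSdef, Set.mem_toFinset]; exact hall x hx
  have hGcard : (Sᶜ).card = 2 ^ M - b := by
    rw [Finset.card_compl, hScard]; simp
  have hG : ∀ w ∈ Sᶜ, w ∉ badWords A M := fun w hw => by
    simpa [hSdef] using hw
  have hGne : (Sᶜ).Nonempty := Finset.card_pos.1 (by omega)
  have h1 := upperBoxDim_le (fun x hx => shift_mem_piece hx) hM hS ⟨_, hS x₀ hx₀⟩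
  have h2 := le_upperBoxDim (A := A) hM hMn hG hGne
  rw [hdim] at h1
  have h3 := h2.trans h1
  rw [EReal.coe_le_coe_iff] at h3
  have hb0 : 0 < b := by
    rw [← hScard]; exact Finset.card_pos.2 ⟨_, hS x₀ hx₀⟩
  have hM0 : (0 : ℝ) < M := by exact_mod_cast hM
  have hl2 : 0 < Real.log 2 := Real.log_pos (by norm_num)
  rw [div_le_div_iff_of_pos_right (by positivity), hScard] at h3
  -- The factor `2` of `upperBoxDim_le` becomes the square in `hcard`: equal dimensions would give
  -- `2 ^ M - b ≤ b ^ 2`.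
  have e : 2 * Real.log b = Real.log ((b ^ 2 : ℕ) : ℝ) := by
    push_cast; rw [Real.log_pow]; norm_num
  rw [e, Real.log_le_log_iff (by exact_mod_cast Finset.card_pos.2 hGne) (by positivity)] at h3
  have h4 : (Sᶜ).card ≤ b ^ 2 := by exact_mod_cast h3
  omega

end WaveletShift

namespace WaveletShift

/-! ### Convergence of the pressures and of their derivatives -/

theorem exists_regular_of_holderWith {φ : Seq → ℝ} {C r : ℝ≥0} (hr : 0 < r)
    (h : HolderWith C r φ) : ∃ C' θ : ℝ, 0 ≤ θ ∧ θ < 1 ∧ Regular φ C' θ := by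
  have hr' : (0 : ℝ) < r := by exact_mod_cast hr
  have hvar : ∀ (m : ℕ) (x y : Seq), Agree m x y →
      |φ x - φ y| ≤ C * ((1 / 2 : ℝ) ^ (r : ℝ)) ^ m := by
    intro m x y hxy
    have h1 := h.dist_le x y
    rw [Real.dist_eq] at h1
    refine h1.trans ?_
    have h2 : dist x y ^ (r : ℝ) ≤ ((1 / 2 : ℝ) ^ m) ^ (r : ℝ) :=
      Real.rpow_le_rpow dist_nonneg (agree_iff_dist_le.1 hxy) hr'.le
    have e : ((1 / 2 : ℝ) ^ m) ^ (r : ℝ) = ((1 / 2 : ℝ) ^ (r : ℝ)) ^ m := by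
      rw [← Real.rpow_natCast, ← Real.rpow_mul (by norm_num), mul_comm,
        Real.rpow_mul (by norm_num), Real.rpow_natCast]
    rw [← e]
    gcongr
  refine ⟨|φ 0| + C, (1 / 2 : ℝ) ^ (r : ℝ), by positivity,
    Real.rpow_lt_one (by norm_num) (by norm_num) hr', fun x => ?_, fun m x y hxy => ?_⟩
  · have h1 := hvar 0 x 0 fun i hi => absurd hi (by omega)
    rw [pow_zero, mul_one] at h1
    have h2 := abs_add_le (φ x - φ 0) (φ 0)
    rw [sub_add_cancel] at h2
    linarith
  · refine (hvar m x y hxy).trans ?_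
    have := abs_nonneg (φ 0)
    gcongr
    linarith

theorem eventually_mul_sq_le_pow (a : ℝ) {r : ℝ} (hr : 1 < r) :
    ∀ᶠ M : ℕ in atTop, a * ((M : ℝ) + 1) ^ 2 ≤ r ^ M := by
  have h1 : Tendsto (fun M : ℕ => (4 * |a|) * ((M : ℝ) ^ 2 / r ^ M)) atTop (𝓝 ((4 * |a|) * 0)) :=
    (tendsto_pow_const_div_const_pow_of_one_lt 2 hr).const_mul _
  rw [mul_zero] at h1
  filter_upwards [h1.eventually (ge_mem_nhds one_pos), eventually_ge_atTop 1] with M hM hM1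
  have hrM : 0 < r ^ M := by positivity
  have hM1' : (1 : ℝ) ≤ M := by exact_mod_cast hM1
  rw [← mul_div_assoc, div_le_one hrM] at hM
  calc a * ((M : ℝ) + 1) ^ 2 ≤ |a| * ((M : ℝ) + M) ^ 2 := by
        gcongr
        exact le_abs_self a
    _ = (4 * |a|) * (M : ℝ) ^ 2 := by ring
    _ ≤ _ := hM

/-- The pressures on zero-avoiding pieces converge to that of the full shift, locally uniformly in
`q`. -/
theorem eventually_abs_pressure_sub_le {ψ : ℝ → ℝ} (hψ : (zeros ψ).Finite) {φ : Seq → ℝ} {C θ : ℝ}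
    (hφ : Regular φ C θ) (hθ0 : 0 ≤ θ) (hθ1 : θ < 1) {k₀ : ℕ} {X : ℕ → Set Seq}
    (hX : ∀ k, k₀ ≤ k → IsZeroAvoidingPiece ψ k (X k)) {Q : ℝ} (hQ : 0 ≤ Q) {ε : ℝ} (hε : 0 < ε) :
    ∀ᶠ k in atTop, ∀ q : ℝ, |q| ≤ Q →
      |pressure (X k) (fun t => q * φ t) - pressure univ (fun t => q * φ t)| ≤ ε := by
  have hC := hφ.nonneg
  have h1θ : 0 < 1 - θ := by linarith
  obtain ⟨c, hc, hbd⟩ := isTransitiveMarkov_univ.exists_pressure_bounds (Q * C) hθ0 hθ1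
  set B : ℝ := Q * C / (1 - θ) with hBdef
  have hB0 : 0 ≤ B := by positivity
  have hB : Q * C ≤ B * (1 - θ) := by rw [hBdef, div_mul_cancel₀ _ h1θ.ne']
  have hρ : 1 < 1 + Real.exp (-(B + 2 * (Q * C))) := by
    have := Real.exp_pos (-(B + 2 * (Q * C)))
    linarith
  -- At most three forbidden words per zero, times `k + 1 ≤ 2 * (M + 1)` positions.
  set a : ℝ := 6 * (zeros ψ).ncard with ha
  have ha0 : 0 ≤ a := by positivity
  have hdiv : Tendsto (fun k : ℕ => k / 2) atTop atTop :=
    Nat.tendsto_div_const_atTop (by norm_num)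
  have e1 := hdiv.eventually (eventually_mul_sq_le_pow (2 * a) hρ)
  have e2 := hdiv.eventually (eventually_mul_sq_le_pow (a ^ 2 + a + 1) one_lt_two)
  have e3 : ∀ᶠ k : ℕ in atTop, (B + Real.log (2 * c)) / ε ≤ ((k / 2 : ℕ) : ℝ) :=
    (tendsto_natCast_atTop_atTop.comp hdiv).eventually_ge_atTop _
  filter_upwards [e1, e2, e3, eventually_ge_atTop k₀, eventually_ge_atTop 2] with
    k h1 h2 h3 hk₀ hk2 q hq
  obtain ⟨⟨u, D, hu, rfl, hXk⟩, hdim⟩ := hX k hk₀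
  have hXk' : X k = piece (admissible ψ k) u := hXk
  rw [hXk'] at hdim ⊢
  set M := k / 2 with hM
  have hM1 : 1 ≤ M := by omega
  have hMk : 2 * M ≤ k := by omega
  have hM0 : (0 : ℝ) < M := by exact_mod_cast hM1
  set b := (badWords (admissible ψ k) M).ncard with hb
  have hbn : (b : ℝ) ≤ a * (M + 1) := by
    have h4 := (ncard_badWords_le (admissible ψ k) M).trans
      (Nat.mul_le_mul_right (k + 1) (ncard_compl_admissible_le hψ k))
    have h5 : k + 1 ≤ 2 * (M + 1) := by omega
    have h6 := h4.trans (Nat.mul_le_mul_left _ h5)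
    have h7 : (b : ℝ) ≤ ((3 * (zeros ψ).ncard * (2 * (M + 1)) : ℕ) : ℝ) := by exact_mod_cast h6
    push_cast at h7
    rw [ha]; linarith
  have hbb : a * ((M : ℝ) + 1) ≤ a * (M + 1) ^ 2 := by
    gcongr
    nlinarith
  have hcard : b ^ 2 + b < 2 ^ M := by
    have h4 : (b : ℝ) ^ 2 + b < 2 ^ M := by
      calc (b : ℝ) ^ 2 + b ≤ (a * (M + 1)) ^ 2 + a * (M + 1) ^ 2 := by
            gcongr
            exact hbn.trans hbb
        _ < (a ^ 2 + a + 1) * (M + 1) ^ 2 := by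
            have : (0 : ℝ) < ((M : ℝ) + 1) ^ 2 := by positivity
            nlinarith
        _ ≤ _ := h2
    exact_mod_cast h4
  obtain ⟨x, hx, hxgood⟩ := exists_pref_notMem_badWords hM1 hMk hu hdim hcard
  have hsub := freeShift_subset_piece hM1 hMk hu hx hxgood
  obtain ⟨R, hR⟩ := exists_isTransitiveMarkov_piece (A := admissible ψ k) (by omega) hu
  have hg : Regular (fun t => q * φ t) (Q * C) θ := (hφ.const_mul q).mono (by gcongr) hθ0
  have hle := hR.pressure_le_univ hg hθ0 hθ1
  -- The error is `(B + log (2 * c)) / M`; `R` depends on `k` without control, but does not enter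
  -- it.
  have hge := hR.pressure_univ_le hg hθ0 hθ1 hB0 hB hc
    (fun n x => ((hbd _ hg).2 n x (mem_univ x)).1) hsub (by rw [← hb]; nlinarith)
  rw [div_le_iff₀ hε] at h3
  rw [abs_le]
  constructor
  · have : (M : ℝ) * pressure univ (fun t => q * φ t) ≤
        M * (pressure (piece (admissible ψ k) u) (fun t => q * φ t) + ε) := by
      rw [mul_add]; linarith
    have := le_of_mul_le_mul_left this hM0
    linarith
  · linarith

/-- For `z` near `q`, the derivative at `z` lies between the slopes from `z` to fixed points on
either side of `q`, and these slopes are continuous in `z`. -/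
theorem continuous_deriv_of_convexOn {f : ℝ → ℝ} (hf : ConvexOn ℝ univ f)
    (hd : Differentiable ℝ f) : Continuous (deriv f) := by
  rw [continuous_iff_continuousAt]
  intro q
  have hsl := hasDerivAt_iff_tendsto_slope.1 (hd q).hasDerivAt
  refine tendsto_order.2 ⟨fun l hl => ?_, fun l hl => ?_⟩
  · have h1 : ∀ᶠ y in 𝓝[<] q, l < slope f q y :=
      (hsl.mono_left (nhdsWithin_mono q fun y hy => ne_of_lt hy)).eventually (lt_mem_nhds hl)
    obtain ⟨y, hy, hyq⟩ := (h1.and self_mem_nhdsWithin).exists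
    have hyq : y < q := hyq
    have hcont : ContinuousAt (fun z => slope f z y) q := by
      simp only [slope_def_field]
      exact (continuousAt_const.sub (hd q).continuousAt).div
        (continuousAt_const.sub continuousAt_id) (sub_ne_zero.2 hyq.ne)
    filter_upwards [hcont.eventually (lt_mem_nhds hy), lt_mem_nhds hyq] with z hz hyz
    rw [slope_comm] at hz
    exact hz.trans_le (hf.slope_le_deriv (mem_univ y) (mem_univ z) hyz (hd z))
  · have h1 : ∀ᶠ y in 𝓝[>] q, slope f q y < l :=
      (hsl.mono_left (nhdsWithin_mono q fun y hy => ne_of_gt hy)).eventually (gt_mem_nhds hl)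
    obtain ⟨y, hy, hyq⟩ := (h1.and self_mem_nhdsWithin).exists
    have hyq : q < y := hyq
    have hcont : ContinuousAt (fun z => slope f z y) q := by
      simp only [slope_def_field]
      exact (continuousAt_const.sub (hd q).continuousAt).div
        (continuousAt_const.sub continuousAt_id) (sub_ne_zero.2 hyq.ne')
    filter_upwards [hcont.eventually (gt_mem_nhds hy), gt_mem_nhds hyq] with z hz hyz
    exact (hf.deriv_le_slope (mem_univ z) (mem_univ y) hyz (hd z)).trans_lt hz

/-- If convex differentiable functions converge locally uniformly to a differentiable function, so
do their derivatives. -/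
theorem tendstoUniformlyOn_deriv_of_convexOn {F : ℕ → ℝ → ℝ} {f : ℝ → ℝ}
    (hF : ∀ᶠ k in atTop, ConvexOn ℝ univ (F k) ∧ Differentiable ℝ (F k))
    (hf : ConvexOn ℝ univ f) (hd : Differentiable ℝ f)
    (hlim : ∀ Q : ℝ, 0 ≤ Q → ∀ ε > 0, ∀ᶠ k in atTop, ∀ q : ℝ, |q| ≤ Q → |F k q - f q| ≤ ε)
    (a b : ℝ) : TendstoUniformlyOn (fun k => deriv (F k)) (deriv f) atTop (Icc a b) := by
  rw [Metric.tendstoUniformlyOn_iff]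
  intro ε hε
  have huc := (isCompact_Icc (a := a - 1) (b := b + 1)).uniformContinuousOn_of_continuous
    (continuous_deriv_of_convexOn hf hd).continuousOn
  obtain ⟨δ, hδ, hδuc⟩ := Metric.uniformContinuousOn_iff.1 huc (ε / 4) (by linarith)
  set h : ℝ := min δ 1 / 2 with hh
  have hh0 : 0 < h := by positivity
  have hhδ : h < δ := by
    have := min_le_left δ 1
    linarith
  have hh1 : h < 1 := by
    have := min_le_right δ 1
    linarith
  -- Convexity puts the derivative of `F k` at `q` between its difference quotients with steps `-h`
  -- and `h`. Errors `ε / 4 * h` at both ends cost `ε / 2` after division by `h`, and the variation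
  -- of `deriv f` costs `ε / 4`.
  filter_upwards [hF, hlim (|a| + |b| + 1) (by positivity) (ε / 4 * h) (by positivity)] with
    k ⟨hkc, hkd⟩ hk q hq
  have hbound : ∀ y, a - 1 ≤ y → y ≤ b + 1 → |y| ≤ |a| + |b| + 1 := by
    intro y h1 h2
    rw [abs_le]
    have := neg_abs_le a
    have := le_abs_self b
    have := abs_nonneg a
    have := abs_nonneg b
    constructor <;> linarith
  obtain ⟨hqa, hqb⟩ := hq
  have k0 := abs_le.1 (hk q (hbound q (by linarith) (by linarith)))
  have k1 := abs_le.1 (hk (q + h) (hbound _ (by linarith) (by linarith)))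
  have k2 := abs_le.1 (hk (q - h) (hbound _ (by linarith) (by linarith)))
  have u1 := hδuc (q + h) ⟨by linarith, by linarith⟩ q ⟨by linarith, by linarith⟩ (by
    rw [Real.dist_eq, add_sub_cancel_left, abs_of_pos hh0]; exact hhδ)
  have u2 := hδuc (q - h) ⟨by linarith, by linarith⟩ q ⟨by linarith, by linarith⟩ (by
    rw [Real.dist_eq, sub_sub_cancel_left, abs_neg, abs_of_pos hh0]; exact hhδ)
  rw [Real.dist_eq, abs_lt] at u1 u2
  have s1 := hkc.deriv_le_slope (mem_univ q) (mem_univ (q + h)) (by linarith) (hkd q)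
  have s2 := hkc.slope_le_deriv (mem_univ (q - h)) (mem_univ q) (by linarith) (hkd q)
  have s3 := hf.slope_le_deriv (mem_univ q) (mem_univ (q + h)) (by linarith) (hd _)
  have s4 := hf.deriv_le_slope (mem_univ (q - h)) (mem_univ q) (by linarith) (hd _)
  rw [slope_def_field, add_sub_cancel_left, le_div_iff₀ hh0] at s1
  rw [slope_def_field, sub_sub_cancel, div_le_iff₀ hh0] at s2
  rw [slope_def_field, add_sub_cancel_left, div_le_iff₀ hh0] at s3
  rw [slope_def_field, sub_sub_cancel, le_div_iff₀ hh0] at s4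
  rw [dist_comm, Real.dist_eq, abs_lt]
  constructor
  · have : (deriv f q - 3 * (ε / 4)) * h ≤ deriv (F k) q * h := by nlinarith
    have := le_of_mul_le_mul_right this hh0
    linarith
  · have : deriv (F k) q * h ≤ (deriv f q + 3 * (ε / 4)) * h := by nlinarith
    have := le_of_mul_le_mul_right this hh0
    linarith

end WaveletShift
-- The main theorem
open WaveletShift in
theorem mainTheorem3 (ψ : ℝ → ℝ) (hψ : (zeros ψ).Finite)
    (φ : Seq → ℝ) (hφ : ∃ C r : ℝ≥0, 0 < r ∧ HolderWith C r φ)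
    (k₀ : ℕ) (hk₀ : 2 ≤ k₀) (X : ℕ → Set Seq)
    (hX : ∀ k, k₀ ≤ k → IsZeroAvoidingPiece ψ k (X k)) :
    -- the limits defining the pressures exist
    (∀ q : ℝ, Tendsto (pressureSeq univ (fun t => q * φ t)) atTop
      (𝓝 (pressure univ (fun t => q * φ t)))) ∧
    (∀ k, k₀ ≤ k → ∀ q : ℝ, Tendsto (pressureSeq (X k) (fun t => q * φ t)) atTop
      (𝓝 (pressure (X k) (fun t => q * φ t)))) ∧
    -- the pressures are differentiable functions of `q`
    Differentiable ℝ (fun q : ℝ => pressure univ (fun t => q * φ t)) ∧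
    (∀ k, k₀ ≤ k → Differentiable ℝ (fun q : ℝ => pressure (X k) (fun t => q * φ t))) ∧
    -- pointwise convergence of the pressures
    (∀ q : ℝ, Tendsto (fun k => pressure (X k) (fun t => q * φ t)) atTop
      (𝓝 (pressure univ (fun t => q * φ t)))) ∧
    -- uniform convergence on compact intervals of the pressures and of their derivatives
    (∀ a b : ℝ,
      TendstoUniformlyOn (fun (k : ℕ) (q : ℝ) => pressure (X k) (fun t => q * φ t))
        (fun q : ℝ => pressure univ (fun t => q * φ t)) atTop (Icc a b) ∧
      TendstoUniformlyOn
        (fun (k : ℕ) (q : ℝ) => deriv (fun q' : ℝ => pressure (X k) (fun t => q' * φ t)) q)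
        (fun q : ℝ => deriv (fun q' : ℝ => pressure univ (fun t => q' * φ t)) q)
        atTop (Icc a b)) := by
  obtain ⟨C₀, r, hr, hH⟩ := hφ
  obtain ⟨C, θ, hθ0, hθ1, hreg⟩ := exists_regular_of_holderWith hr hH
  have hmarkov : ∀ k, k₀ ≤ k → ∃ m R, IsTransitiveMarkov m R (X k) := by
    intro k hk
    obtain ⟨⟨u, D, hu, rfl, hXk⟩, -⟩ := hX k hk
    obtain ⟨R, hR⟩ := exists_isTransitiveMarkov_piece (A := admissible ψ k) (by omega) hu
    rw [hXk]
    exact ⟨_, R, hR⟩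
  have hlimit : ∀ {m R : ℕ} {Y : Set Seq}, IsTransitiveMarkov m R Y → ∀ q : ℝ,
      Tendsto (pressureSeq Y (fun t => q * φ t)) atTop (𝓝 (pressure Y (fun t => q * φ t))) := by
    intro m R Y hY q
    obtain ⟨c, -, h⟩ := hY.exists_pressure_bounds (|q| * C) hθ0 hθ1
    exact (h _ (hreg.const_mul q)).1
  have hconv : ∀ Q : ℝ, 0 ≤ Q → ∀ ε > 0, ∀ᶠ k in atTop, ∀ q : ℝ, |q| ≤ Q →
      |pressure (X k) (fun t => q * φ t) - pressure univ (fun t => q * φ t)| ≤ ε :=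
    fun Q hQ ε hε => eventually_abs_pressure_sub_le hψ hreg hθ0 hθ1 hX hQ hε
  have hunif : ∀ a b : ℝ,
      TendstoUniformlyOn (fun (k : ℕ) (q : ℝ) => pressure (X k) (fun t => q * φ t))
        (fun q : ℝ => pressure univ (fun t => q * φ t)) atTop (Icc a b) := by
    intro a b
    rw [Metric.tendstoUniformlyOn_iff]
    intro ε hε
    filter_upwards [hconv (|a| + |b|) (by positivity) (ε / 2) (by linarith)] with k hk q hq
    rw [dist_comm, Real.dist_eq]
    refine (hk q ?_).trans_lt (by linarith)
    rw [abs_le]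
    have := neg_abs_le a
    have := le_abs_self b
    have := abs_nonneg a
    have := abs_nonneg b
    constructor <;> linarith [hq.1, hq.2]
  refine ⟨hlimit isTransitiveMarkov_univ, fun k hk => ?_,
    isTransitiveMarkov_univ.differentiable_pressure hreg hθ0 hθ1, fun k hk => ?_, fun q => ?_,
    fun a b => ⟨hunif a b, ?_⟩⟩
  · obtain ⟨m, R, hR⟩ := hmarkov k hk
    exact hlimit hR
  · obtain ⟨m, R, hR⟩ := hmarkov k hk
    exact hR.differentiable_pressure hreg hθ0 hθ1
  · exact (hunif q q).tendsto_at (left_mem_Icc.2 le_rfl)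
  · refine tendstoUniformlyOn_deriv_of_convexOn ?_
      (isTransitiveMarkov_univ.convexOn_pressure hreg hθ0 hθ1)
      (isTransitiveMarkov_univ.differentiable_pressure hreg hθ0 hθ1) hconv a b
    filter_upwards [eventually_ge_atTop k₀] with k hk
    obtain ⟨m, R, hR⟩ := hmarkov k hk
    exact ⟨hR.convexOn_pressure hreg hθ0 hθ1, hR.differentiable_pressure hreg hθ0 hθ1⟩
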